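/- **Setting.** Let $p\ge 1$. A dataset is a finite set of items $(\mathrm{key},\mathrm{val})$ with $\mathrm{val}\in\mathbb R^d$ in which every key occurs with one value only; datasets are conforming if every key present in two of them has the same value in both. $\mathcal A.\mathrm{vals}$ is the matrix whose rows are the values of the items of $\mathcal A$. For a matrix $M$ with $d$ columns and $a\in\mathbb R^d$ put $\tau^{\ell_p}_M(a)=\max_{x:\,Mx\ne 0}|\langle a,x\rangle|^p/\|Mx\|_p^p$ (and $0$ if $M=0$). Let $h_1,h_2,\dots$ be independent fully random hash functions: all values $h_i(\mathrm{key})$ are independent and uniform on $[0,1]$. Given $C,\varepsilon,\delta$, write $\pi(\tau)=C\,\tau\,\bigl(d\log(d/\varepsilon)+\log(1/\delta)\bigr)\varepsilon^{-2}$. **Sketches.** A random $t$-tuple $(S_1,\dots,S_t)$ (or the symbol FAIL) is a sketch $\mathrm{sk}_{t,\gamma}(\mathcal A)$, constructed with $h_1,\dots,h_t$ and the parameters $\varepsilon,\delta$ from side randomness $\mathcal G$ (a $\sigma$-algebra independent of $h_1,\dots,h_t$), if there are $\mathcal G$-measurable estimates $\tilde\tau_{\mathrm{key}}$ and an event in $\mathcal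 G$ of probability at least $1-\gamma$ on which $$(1+\varepsilon)^t\,\tau^{\ell_p}_{\mathcal A.\mathrm{vals}}(\mathrm{val})\le\tilde\tau_{\mathrm{key}}\le(1+\varepsilon)^{t+1}\,\tau^{\ell_p}_{\mathcal A.\mathrm{vals}}(\mathrm{val})\quad\text{for all }(\mathrm{key},\mathrm{val})\in\mathcal A,$$ the sketch is not FAIL, and, for $i=1,\dots,t$, $$S_i=\{(\mathrm{key},\mathrm{val},\min(\pi(\tilde\tau_{\mathrm{key}}),1)) : (\mathrm{key},\mathrm{val})\in\mathcal A,\ h_i(\mathrm{key})\le\pi(\tilde\tau_{\mathrm{key}})\}.$$ **Merging algorithm.** Given $s\ge1$ tuples $(S^{(j)}_1,\dots,S^{(j)}_{t_j})$ with all $t_j\ge1$, put $t=\min_j t_j$ and $U_i=\bigcup_j S^{(j)}_i$ for $i\le t$. For an item $(\mathrm{key},\mathrm{val})$ occurring in $U_i$ let $q_i(\mathrm{key},\mathrm{val})$ be the largest $q$ with $(\mathrm{key},\mathrm{val},q)\in U_i$. Let $M$ be the matrix with one row $(1/q_t(\mathrm{key},\mathrm{val}))^{1/p}\,\mathrm{val}$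 for each item occurring in $U_t$. For $i=1,\dots,t-1$ and each item occurring in $U_i$ put $\tilde p=\pi\bigl((1+\varepsilon)^{t-1}(1+\varepsilon/4)\,\tau^{\ell_p}_M(\mathrm{val})\bigr)$; if $\min(1,\tilde p)>q_i(\mathrm{key},\mathrm{val})$ for one of them, output FAIL; otherwise let $S_i$ be the set of the tuples $(\mathrm{key},\mathrm{val},\min(1,\tilde p))$ for the items occurring in $U_i$ with $h_i(\mathrm{key})\le\tilde p$. Output $(S_1,\dots,S_{t-1})$. (The output is also FAIL if an input is FAIL.) **Theorem.** For every $p\ge1$ there is a constant $C_0>0$, depending only on $p$, such that the following holds for all $C\ge C_0$, all $d\ge 0$ (with $d\log(d/\varepsilon)=0$ for $d=0$) and all $\varepsilon,\delta\in(0,1)$, with $\varepsilon\delta\le 1/2$ in case $d=1$. Let $\mathcal A_1,\dots,\mathcal A_s$, $s\ge1$, be conforming datasets, and let sketches $\mathrm{sk}_{t_j,\gamma_j}(\mathcal A_j)$, $j=1,\dots,s$, with all $t_j\ge1$ be constructed with the same hash functions $h_1,h_2,\dots$ and the same parameters $C,\varepsilon,\delta$, from side randomness $\mathcal G_1,\dots,\mathcal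 G_s$. Let $t=\min_j t_j$ and suppose that $\mathcal G_1,\dots,\mathcal G_s$ are jointly independent of $h_1,\dots,h_t$, i.e. the $\sigma$-algebra $\mathcal G_1\vee\dots\vee\mathcal G_s$ is independent of $(h_1,\dots,h_t)$. Then the output of the merging algorithm is a sketch $\mathrm{sk}_{t-1,\ \delta+\gamma_1+\dots+\gamma_s}(\mathcal A_1\cup\dots\cup\mathcal A_s)$, constructed with $h_1,\dots,h_{t-1}$ and the same parameters, from the side randomness generated by $\mathcal G_1,\dots,\mathcal G_s$ and $h_t$. Here an item that occurs in several $\mathcal A_j$ counts once in the union. -/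

import Mathlib

open MeasureTheory ProbabilityTheory

noncomputable section

/-! ### Datasets -/

/-- A finite collection of items `(key, val)` with `d`-dimensional values. -/
abbrev Items (T : Type*) (d : ℕ) := Finset (T × (Fin d → ℝ))

/-- For every key present in both collections the corresponding values agree. -/
def Conforming {T : Type*} {d : ℕ} (A B : Items T d) : Prop :=
  ∀ a ∈ A, ∀ b ∈ B, a.1 = b.1 → a.2 = b.2

/-- A dataset: every key occurs with one value only. -/
def IsDataset {T : Type*} {d : ℕ} (A : Items T d) : Prop := Conforming A A

open scoped Classical in
/-- The union of the datasets; an item that lies in several of them is kept once. -/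
def unionItems {T : Type*} {d s : ℕ} (A : Fin s → Items T d) : Items T d :=
  Finset.univ.biUnion A

/-- The matrix `A.vals`, with one row for every item. -/
def vals {T : Type*} {d : ℕ} (A : Items T d) : Matrix A (Fin d) ℝ :=
  Matrix.of fun a => a.1.2

/-! ### Sensitivities -/

/-- `‖y‖_p ^ p`. -/
def lpPow {n : Type*} [Fintype n] (p : ℝ) (y : n → ℝ) : ℝ := ∑ i, |y i| ^ p

/-- The `ℓ_p` sensitivity of `a` with respect to the matrix `M`: the maximum of
`|⟨a, x⟩| ^ p / ‖M x‖_p ^ p` over all `x` with `M x ≠ 0` (and `0` if there is no such `x`). -/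
def sensitivity {n : Type*} [Fintype n] {d : ℕ} (p : ℝ) (M : Matrix n (Fin d) ℝ)
    (a : Fin d → ℝ) : ℝ :=
  sSup {r : ℝ | ∃ x : Fin d → ℝ, M.mulVec x ≠ 0 ∧ r = |a ⬝ᵥ x| ^ p / lpPow p (M.mulVec x)}

/-! ### Sketches -/

/-- The parameters of the sketches: the exponent `p`, the constant `C` in the sampling
probabilities, the accuracy `ε` and the failure probability `δ`. -/
structure SketchParams where
  p : ℝ
  C : ℝ
  ε : ℝ
  δ : ℝ

/-- The (unclipped) sampling probability `C τ (d log (d / ε) + log (1 / δ)) ε⁻²`. -/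
def sampleProb (P : SketchParams) (d : ℕ) (τ : ℝ) : ℝ :=
  P.C * τ * (d * Real.log (d / P.ε) + Real.log (1 / P.δ)) / P.ε ^ 2

/-- A finite set of tuples `(key, val, probability value)`. -/
abbrev Tuples (T : Type*) (d : ℕ) := Finset (T × (Fin d → ℝ) × ℝ)

/-- A sketch with `t` copies of the `senSample` data structure. -/
abbrev Sketch (T : Type*) (d t : ℕ) := Fin t → Tuples T d

open scoped Classical in
/-- The tuples `(key, val, min (p_key, 1))` for `(key, val) ∈ A` with `h key ≤ p_key`, where
`p_key` is the sampling probability for the estimate `τ key`. -/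
def senSample {T : Type*} {d : ℕ} (P : SketchParams) (A : Items T d) (h : T → ℝ) (τ : T → ℝ) :
    Tuples T d :=
  (A.filter fun a => h a.1 ≤ sampleProb P d (τ a.1)).image
    fun a => (a.1, a.2, min (sampleProb P d (τ a.1)) 1)

/-- Independent fully random hash functions `h 0, h 1, …`: the values `h i key` are independent
and uniform in `[0, 1]`. -/
structure IsRandomHash {T Ω : Type*} [MeasurableSpace Ω] (μ : Measure Ω) (h : ℕ → T → Ω → ℝ) :
    Prop where
  measurable : ∀ i k, Measurable (h i k)
  uniform : ∀ i k, μ.map (h i k) = volume.restrict (Set.Icc (0 : ℝ) 1)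
  indep : iIndepFun (fun ik : ℕ × T => h ik.1 ik.2) μ

/-- The σ-algebra generated by the hash functions `h i`, `i ∈ I`. -/
abbrev hashSigma {T Ω : Type*} (h : ℕ → T → Ω → ℝ) (I : Set ℕ) : MeasurableSpace Ω :=
  ⨆ i ∈ I, ⨆ k, MeasurableSpace.comap (h i k) inferInstance

/-- The random sketch `S` (with value `none` where its construction failed) is
`sk_{t,γ}(A)`, constructed with the hash functions `h 0, …, h (t - 1)`. The σ-algebra `𝒢` is the
randomness from which the sensitivity estimates `τ` are computed. It is independent of these
`t` hash functions. With probability at least `1 - γ` over `𝒢`, the estimates are correct and each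
copy in the sketch is the sample that they and the respective hash function determine. -/
structure IsSketch {T Ω : Type*} [mΩ : MeasurableSpace Ω] {d : ℕ} (μ : Measure Ω)
    (h : ℕ → T → Ω → ℝ) (P : SketchParams) (𝒢 : MeasurableSpace Ω) (t : ℕ) (γ : ℝ)
    (A : Items T d) (S : Ω → Option (Sketch T d t)) : Prop where
  le : 𝒢 ≤ mΩ
  indep : Indep 𝒢 (hashSigma h (Set.Iio t)) μ
  exists_estimates : ∃ τ : T → Ω → ℝ, (∀ k, Measurable[𝒢] (τ k)) ∧
    ∃ E : Set Ω, MeasurableSet[𝒢] E ∧ 1 - γ ≤ μ.real E ∧ ∀ ω ∈ E,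
      (∀ a ∈ A,
        (1 + P.ε) ^ t * sensitivity P.p (vals A) a.2 ≤ τ a.1 ω ∧
        τ a.1 ω ≤ (1 + P.ε) ^ (t + 1) * sensitivity P.p (vals A) a.2) ∧
      S ω = some fun i : Fin t => senSample P A (fun k => h i k ω) (fun k => τ k ω)

/-! ### The merging algorithm -/

open scoped Classical in
/-- The items `(key, val)` that occur in some tuple. -/
def sampledItems {T : Type*} {d : ℕ} (U : Tuples T d) : Items T d :=
  U.image fun u => (u.1, u.2.1)

/-- The largest probability value stored in `U` with the item `a`. -/
def maxProb {T : Type*} {d : ℕ} (U : Tuples T d) (a : T × (Fin d → ℝ)) : ℝ :=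
  sSup {q : ℝ | (a.1, a.2, q) ∈ U}

/-- The matrix with rows `(1 / q) ^ (1 / p) • val` for the items `(key, val)` in `U`, where `q` is
the largest probability value stored with the item. -/
def sampledMatrix {T : Type*} {d : ℕ} (p : ℝ) (U : Tuples T d) :
    Matrix (sampledItems U) (Fin d) ℝ :=
  Matrix.of fun a => ((1 / maxProb U a.1) ^ (1 / p)) • a.1.2

open scoped Classical in
/-- The union over all given sketches of their copies with index `i`. -/
def copyUnion {T : Type*} {d s m : ℕ} {t : Fin s → ℕ} (hm : ∀ j, m + 1 ≤ t j)
    (S : ∀ j, Sketch T d (t j)) (i : Fin (m + 1)) : Tuples T d :=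
  Finset.univ.biUnion fun j => S j (Fin.castLE (hm j) i)

open scoped Classical in
/-- Merging of sketches that have at least `m + 1` copies each, for hash functions with values
`h i key`. The copies with index `m` yield a matrix and from it estimates of the sensitivities;
the copies with index `i < m` are resampled with these estimates. The value `none` stands for the
output FAIL. -/
def mergeSketches {T : Type*} {d s m : ℕ} {t : Fin s → ℕ} (P : SketchParams) (h : ℕ → T → ℝ)
    (hm : ∀ j, m + 1 ≤ t j) (S : ∀ j, Sketch T d (t j)) : Option (Sketch T d m) :=
  let M := sampledMatrix P.p (copyUnion hm S (Fin.last m))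
  let τ : (Fin d → ℝ) → ℝ := fun v =>
    (1 + P.ε) ^ m * (1 + P.ε / 4) * sensitivity P.p M v
  if ∃ i : Fin m, ∃ a ∈ sampledItems (copyUnion hm S i.castSucc),
      maxProb (copyUnion hm S i.castSucc) a < min 1 (sampleProb P d (τ a.2)) then
    none
  else
    some fun i : Fin m =>
      ((sampledItems (copyUnion hm S i.castSucc)).filter
          fun a => h i a.1 ≤ sampleProb P d (τ a.2)).image
        fun a => (a.1, a.2, min 1 (sampleProb P d (τ a.2)))

open scoped Classical in
/-- The merging algorithm, with output FAIL if the construction of an input failed already. -/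
def mergeOrFail {T : Type*} {d s m : ℕ} {t : Fin s → ℕ} (P : SketchParams) (h : ℕ → T → ℝ)
    (hm : ∀ j, m + 1 ≤ t j) (S : ∀ j, Option (Sketch T d (t j))) : Option (Sketch T d m) :=
  if hS : ∀ j, (S j).isSome then mergeSketches P h hm fun j => (S j).get (hS j) else none

end

/-! Write `t = m + 1`; hash functions are indexed from `0`, so `h m` is the last one the inputs
share. Because all inputs use the same hash functions, an item survives in some input's copy `i`
exactly when its hash value is at most the largest of its sampling probabilities. Thus the union of
the copies `i` is itself one sample of the union `B` of the datasets, with probabilities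
`unionProb`. Sensitivities only drop when rows are added and every `t j` is at least `m + 1`, so on
the good events of the inputs these probabilities are at least `π((1+ε)^(m+1) · sensitivity in B)`.

The estimates come from side randomness independent of `h m`. Once they are fixed, copy `m` is a
fresh sensitivity sample of `B`: Chernoff bounds for one vector, a union bound over a net of the
range of `vals B` in `ℓ_p`, and extension from the net to the range show that, outside an event of
probability `δ`, the reweighted sample `M` preserves all `‖·‖_p^p` up to `1 ± ε/4`
(`exists_finite_test`, `measureReal_le_of_indepFun`).

Then `(1+ε/4) · sensitivity in M` lies between the sensitivity in `B` and `1+ε` times it, so the new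
estimates have the accuracy required with `m` copies (`sampleEstimate_spec`). They are at most
`(1+ε)^(m+1)` times the sensitivity, so no new probability exceeds an old one: FAIL does not occur,
and resampling a copy `i < m` gives exactly the sample of `B` with the new probabilities
(`mergeSketches_senSample`). The new estimates depend only on the old side randomness and `h m`, and
this is independent of `h 0, …, h (m-1)`. -/

noncomputable section

/-! ### Nets of the unit sphere -/

/-- Volume bound for the size of an `η`-separated subset of the unit ball. -/
theorem card_le_of_separated_unitBall {E : Type*} [NormedAddCommGroup E] [NormedSpace ℝ E]
    [FiniteDimensional ℝ E] {η : ℝ} (hη : 0 < η) (hη1 : η ≤ 1) (s : Finset E)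
    (hs : ∀ c ∈ s, ‖c‖ ≤ 1) (h : ∀ c ∈ s, ∀ e ∈ s, c ≠ e → η ≤ ‖c - e‖) :
    (s.card : ℝ) ≤ (3 / η) ^ Module.finrank ℝ E := by
  borelize E
  let μ : Measure E := Measure.addHaar
  have hr : 0 < η / 2 := by positivity
  have hρ : 0 < 1 + η / 2 := by positivity
  have D : Set.Pairwise (s : Set E)
      (Function.onFun Disjoint fun c => Metric.ball (c : E) (η / 2)) := by
    rintro c hc e he hce
    apply Metric.ball_disjoint_ball
    rw [dist_eq_norm, add_halves]
    exact h c hc e he hce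
  have hsub : (⋃ c ∈ s, Metric.ball (c : E) (η / 2)) ⊆ Metric.ball (0 : E) (1 + η / 2) := by
    refine Set.iUnion₂_subset fun x hx => Metric.ball_subset_ball' ?_
    rw [dist_zero_right]
    linarith [hs x hx]
  have I : (s.card : ENNReal) * ENNReal.ofReal ((η / 2) ^ Module.finrank ℝ E) *
      μ (Metric.ball 0 1) ≤
      ENNReal.ofReal ((1 + η / 2) ^ Module.finrank ℝ E) * μ (Metric.ball 0 1) :=
    calc
      _ = μ (⋃ c ∈ s, Metric.ball (c : E) (η / 2)) := by
        rw [measure_biUnion_finset D fun c _ => measurableSet_ball]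
        simp only [μ.addHaar_ball_of_pos _ hr, Finset.sum_const, nsmul_eq_mul, mul_assoc]
      _ ≤ μ (Metric.ball (0 : E) (1 + η / 2)) := measure_mono hsub
      _ = _ := by simp only [μ.addHaar_ball_of_pos _ hρ]
  have J := (ENNReal.mul_le_mul_iff_left
    (Metric.measure_ball_pos μ _ zero_lt_one).ne' measure_ball_lt_top.ne).1 I
  have K : (s.card : ℝ) * (η / 2) ^ Module.finrank ℝ E ≤
      (1 + η / 2) ^ Module.finrank ℝ E := by
    have := ENNReal.toReal_le_of_le_ofReal (by positivity) J
    rwa [ENNReal.toReal_mul, ENNReal.toReal_natCast,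
      ENNReal.toReal_ofReal (by positivity)] at this
  rw [← le_div_iff₀ (by positivity), ← div_pow] at K
  refine K.trans (pow_le_pow_left₀ (by positivity) ?_ _)
  -- The ratio of the radii is `(2 + η) / η`, and `η ≤ 1`.
  rw [div_le_div_iff₀ hr hη]
  nlinarith

/-- The unit sphere has an `η`-net with at most `(3 / η) ^ dim` points. -/
theorem exists_sphere_net (E : Type*) [NormedAddCommGroup E] [NormedSpace ℝ E]
    [FiniteDimensional ℝ E] {η : ℝ} (hη : 0 < η) (hη1 : η ≤ 1) :
    ∃ s : Finset E, (∀ c ∈ s, ‖c‖ = 1) ∧ (∀ x : E, ‖x‖ = 1 → ∃ c ∈ s, ‖x - c‖ ≤ η) ∧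
      (s.card : ℝ) ≤ (3 / η) ^ Module.finrank ℝ E := by
  classical
  let P : Finset E → Prop := fun s =>
    (∀ c ∈ s, ‖c‖ = 1) ∧ ∀ c ∈ s, ∀ e ∈ s, c ≠ e → η ≤ ‖c - e‖
  have hP : ∀ s, P s → (s.card : ℝ) ≤ (3 / η) ^ Module.finrank ℝ E := fun s hs =>
    card_le_of_separated_unitBall hη hη1 s (fun c hc => (hs.1 c hc).le) hs.2
  have hbdd : BddAbove {n | ∃ s, P s ∧ s.card = n} := by
    refine ⟨⌊(3 / η) ^ Module.finrank ℝ E⌋₊, ?_⟩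
    rintro _ ⟨s, hs, rfl⟩
    exact Nat.le_floor (hP s hs)
  have hne : {n | ∃ s, P s ∧ s.card = n}.Nonempty := ⟨0, ∅, by simp [P], rfl⟩
  -- A separated set of largest cardinality is a net, since an uncovered point could be added to it.
  obtain ⟨s, hs, hcard⟩ := Nat.sSup_mem hne hbdd
  refine ⟨s, hs.1, fun x hx => ?_, hP s hs⟩
  by_contra! hfar
  have hxs : x ∉ s := fun hxs => by simpa [hη.le.not_gt] using hfar x hxs
  have hins : P (insert x s) := by
    refine ⟨fun c hc => ?_, fun c hc e he hce => ?_⟩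
    · rcases Finset.mem_insert.1 hc with rfl | hc
      exacts [hx, hs.1 c hc]
    · rcases Finset.mem_insert.1 hc with rfl | hc' <;>
        rcases Finset.mem_insert.1 he with rfl | he'
      · exact absurd rfl hce
      · exact (hfar e he').le
      · rw [norm_sub_rev]; exact (hfar c hc').le
      · exact hs.2 c hc' e he' hce
  have := le_csSup hbdd ⟨_, hins, rfl⟩
  rw [← hcard, Finset.card_insert_of_notMem hxs] at this
  omega

/-- An operator that almost preserves the norms of the points of a net of the unit sphere almost
preserves all norms. -/
theorem norm_map_bounds_of_net {E F : Type*} [NormedAddCommGroup E] [NormedSpace ℝ E]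
    [NormedAddCommGroup F] [NormedSpace ℝ F] (f : E →L[ℝ] F) {η : ℝ}
    (hη : 0 < η) (hη1 : η ≤ 1 / 3) (s : Set E)
    (hcov : ∀ x : E, ‖x‖ = 1 → ∃ c ∈ s, ‖x - c‖ ≤ η)
    (hlow : ∀ c ∈ s, 1 - η ≤ ‖f c‖) (hupp : ∀ c ∈ s, ‖f c‖ ≤ 1 + η) (x : E) :
    (1 - 3 * η) * ‖x‖ ≤ ‖f x‖ ∧ ‖f x‖ ≤ (1 + 3 * η) * ‖x‖ := by
  have hsphere : ∀ x : E, ‖x‖ = 1 → ‖f x‖ ≤ 1 + η + η * ‖f‖ := by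
    intro x hx
    obtain ⟨c, hc, hxc⟩ := hcov x hx
    calc ‖f x‖ = ‖f c + f (x - c)‖ := by simp
      _ ≤ ‖f c‖ + ‖f (x - c)‖ := norm_add_le _ _
      _ ≤ (1 + η) + ‖f‖ * η :=
        add_le_add (hupp c hc) ((f.le_opNorm _).trans
          (mul_le_mul_of_nonneg_left hxc (norm_nonneg f)))
      _ = _ := by ring
  have hnn := norm_nonneg f
  have hop : ‖f‖ ≤ 1 + η + η * ‖f‖ := by
    refine f.opNorm_le_of_unit_norm (by positivity) fun x hx => hsphere x hx
  -- Solving for `‖f‖` gives `(1 + η) / (1 - η)`, which is at most `1 + 3η` exactly because `η ≤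
  -- 1/3`.
  have hop' : ‖f‖ ≤ 1 + 3 * η := by nlinarith
  rcases eq_or_ne x 0 with rfl | hx
  · simp
  have hx' : 0 < ‖x‖ := norm_pos_iff.2 hx
  refine ⟨?_, (f.le_opNorm x).trans (mul_le_mul_of_nonneg_right hop' hx'.le)⟩
  have hu : ‖(‖x‖⁻¹ • x)‖ = 1 := by
    rw [norm_smul, norm_inv, norm_norm, inv_mul_cancel₀ hx'.ne']
  obtain ⟨c, hc, hxc⟩ := hcov _ hu
  have h1 : ‖f c‖ ≤ ‖f (‖x‖⁻¹ • x)‖ + ‖f‖ * η :=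
    calc ‖f c‖ = ‖f (‖x‖⁻¹ • x) - f (‖x‖⁻¹ • x - c)‖ := by
          rw [← map_sub, sub_sub_cancel]
      _ ≤ _ := (norm_sub_le _ _).trans (add_le_add le_rfl ((f.le_opNorm _).trans
          (mul_le_mul_of_nonneg_left hxc (norm_nonneg f))))
  rw [map_smul, norm_smul, norm_inv, norm_norm] at h1
  have h2 : 1 - 3 * η ≤ ‖x‖⁻¹ * ‖f x‖ := by nlinarith [hlow c hc]
  rwa [inv_mul_eq_div, le_div_iff₀ hx'] at h2

/-! ### From a net to all vectors, for weighted sums of powers -/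

theorem norm_rpow_eq_lpPow {ι : Type*} [Fintype ι] {p : ℝ} (hp : 0 < p)
    [Fact (1 ≤ ENNReal.ofReal p)] (y : PiLp (ENNReal.ofReal p) fun _ : ι => ℝ) :
    ‖y‖ ^ p = lpPow p y.ofLp := by
  have htr : (ENNReal.ofReal p).toReal = p := ENNReal.toReal_ofReal hp.le
  rw [PiLp.norm_eq_sum (by rwa [htr]), htr, ← Real.rpow_mul
    (Finset.sum_nonneg fun i _ => by positivity), one_div, inv_mul_cancel₀ hp.ne', Real.rpow_one]
  simp [lpPow]

/-- If weighted sums of `p`-th powers are accurate on a net of a subspace, they are accurate on the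
subspace. -/
theorem weighted_lpPow_bounds_of_net {ι : Type*} [Fintype ι] {p ε : ℝ} (hp : 1 ≤ p) (hε : 0 < ε)
    (hε1 : ε < 1) {η : ℝ} (hη : η = ε / (24 * p)) [Fact (1 ≤ ENNReal.ofReal p)]
    (W : Submodule ℝ (PiLp (ENNReal.ofReal p) fun _ : ι => ℝ)) (s : Set W)
    (hcov : ∀ x : W, ‖x‖ = 1 → ∃ y ∈ s, ‖x - y‖ ≤ η) (c : ι → ℝ) (hc : ∀ i, 0 ≤ c i)
    (hs : ∀ y ∈ s, |∑ i, c i * |y.1 i| ^ p - 1| ≤ η) (x : W) :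
    (1 - ε / 4) * lpPow p x.1.ofLp ≤ ∑ i, c i * |x.1 i| ^ p ∧
      ∑ i, c i * |x.1 i| ^ p ≤ (1 + ε / 4) * lpPow p x.1.ofLp := by
  have hp0 : 0 < p := by linarith
  have hη0 : 0 < η := by rw [hη]; positivity
  have hηp : 24 * (η * p) = ε := by rw [hη]; field_simp
  have hη1 : η ≤ ε / 24 := by nlinarith
  -- Scaling the coordinates by `c i ^ (1/p)` turns the weighted sum into the `p`-th power of the
  -- norm of a linear image, to which the net argument for operators applies.
  let g : (PiLp (ENNReal.ofReal p) fun _ : ι => ℝ) →ₗ[ℝ] PiLp (ENNReal.ofReal p) fun _ : ι => ℝ :=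
    { toFun := fun y => WithLp.toLp _ fun i => c i ^ (1 / p) * y i
      map_add' := fun y z => by ext i; simp [mul_add]
      map_smul' := fun a y => by ext i; simp [mul_left_comm] }
  let f : W →L[ℝ] PiLp (ENNReal.ofReal p) fun _ : ι => ℝ :=
    LinearMap.toContinuousLinearMap (g ∘ₗ W.subtype)
  have hf : ∀ y : W, ‖f y‖ ^ p = ∑ i, c i * |y.1 i| ^ p := by
    intro y
    rw [norm_rpow_eq_lpPow hp0]
    refine Finset.sum_congr rfl fun i _ => ?_
    have : (f y) i = c i ^ (1 / p) * y.1 i := rfl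
    rw [this, abs_mul, abs_of_nonneg (Real.rpow_nonneg (hc i) _),
      Real.mul_rpow (Real.rpow_nonneg (hc i) _) (abs_nonneg _), ← Real.rpow_mul (hc i), one_div,
      inv_mul_cancel₀ hp0.ne', Real.rpow_one]
  -- Since `p ≥ 1`, taking `p`-th roots brings a number in `[1 - η, 1 + η]` no further from `1`.
  have hbd := norm_map_bounds_of_net f hη0 (by linarith) s hcov
    (fun y hy => by
      have h1 := (abs_le.1 (hs y hy)).1
      rw [← hf] at h1
      refine (Real.rpow_le_rpow_iff (by linarith) (norm_nonneg _) hp0).1 ?_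
      have := Real.rpow_le_rpow_of_exponent_ge (x := 1 - η) (by linarith) (by linarith) hp
      rw [Real.rpow_one] at this
      linarith)
    (fun y hy => by
      have h1 := (abs_le.1 (hs y hy)).2
      rw [← hf] at h1
      refine (Real.rpow_le_rpow_iff (norm_nonneg _) (by linarith) hp0).1 ?_
      have := Real.rpow_le_rpow_of_exponent_le (x := 1 + η) (by linarith) hp
      rw [Real.rpow_one] at this
      linarith) x
  have hx : ‖x‖ ^ p = lpPow p x.1.ofLp := norm_rpow_eq_lpPow hp0 x.1
  rw [← hf, ← hx]
  have hxn := Real.rpow_nonneg (norm_nonneg x) p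
  constructor
  -- The constant `24` makes `3ηp = ε/8`: Bernoulli gives `1 - ε/8` here, and `exp (ε/8) ≤ 1 + ε/4`
  -- serves the upper bound.
  · calc (1 - ε / 4) * ‖x‖ ^ p ≤ (1 - 3 * η) ^ p * ‖x‖ ^ p := by
          refine mul_le_mul_of_nonneg_right ?_ hxn
          have := one_add_mul_self_le_rpow_one_add (s := -(3 * η)) (by linarith) hp
          rw [← sub_eq_add_neg] at this
          nlinarith
      _ = ((1 - 3 * η) * ‖x‖) ^ p := (Real.mul_rpow (by linarith) (norm_nonneg _)).symm
      _ ≤ ‖f x‖ ^ p := Real.rpow_le_rpow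
          (mul_nonneg (by linarith) (norm_nonneg _)) hbd.1 hp0.le
  · calc ‖f x‖ ^ p ≤ ((1 + 3 * η) * ‖x‖) ^ p := Real.rpow_le_rpow (norm_nonneg _) hbd.2 hp0.le
      _ = (1 + 3 * η) ^ p * ‖x‖ ^ p := Real.mul_rpow (by linarith) (norm_nonneg _)
      _ ≤ (1 + ε / 4) * ‖x‖ ^ p := by
          refine mul_le_mul_of_nonneg_right ?_ hxn
          calc (1 + 3 * η) ^ p ≤ Real.exp (3 * η) ^ p :=
                Real.rpow_le_rpow (by linarith) (by linarith [Real.add_one_le_exp (3 * η)]) hp0.le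
            _ = Real.exp (3 * η * p) := (Real.exp_mul _ _).symm
            _ ≤ 1 + ε / 4 := by
                have h0 : 0 ≤ 3 * η * p := by positivity
                have h1 : 3 * η * p = ε / 8 := by nlinarith
                have := (abs_le.1 (Real.abs_exp_sub_one_sub_id_le (x := 3 * η * p)
                  (by rw [abs_of_nonneg h0]; linarith))).2
                rw [h1] at this ⊢
                nlinarith

/-! ### Concentration of weighted sums -/

/-- The weight of an item with sampling probability `r` and hash value `u`. -/
def sampleWeight (r u : ℝ) : ℝ := if u ≤ r then 1 / min 1 r else 0

theorem sampleWeight_nonneg {r : ℝ} (hr : 0 ≤ r) (u : ℝ) : 0 ≤ sampleWeight r u := by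
  unfold sampleWeight
  split_ifs <;> positivity

theorem measurable_sampleWeight : Measurable fun z : ℝ × ℝ => sampleWeight z.1 z.2 :=
  Measurable.ite (measurableSet_le measurable_snd measurable_fst)
    (measurable_const.div (measurable_const.min measurable_fst)) measurable_const

theorem abs_sampleWeight_le (r u : ℝ) : |sampleWeight r u| ≤ |1 / min 1 r| := by
  unfold sampleWeight
  split_ifs
  · exact le_rfl
  · simp

section Concentration

variable {Ω : Type*} [MeasurableSpace Ω] {μ : Measure Ω} [IsProbabilityMeasure μ]

theorem integrable_exp_sampleWeight {u : Ω → ℝ} (hu : Measurable u) (θ a r : ℝ) :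
    Integrable (fun ω => Real.exp (θ * ((sampleWeight r (u ω) - 1) * a))) μ := by
  refine Integrable.of_bound (C := Real.exp (|θ| * ((|1 / min 1 r| + 1) * |a|))) ?_ ?_
  · have : Measurable fun ω => sampleWeight r (u ω) :=
      measurable_sampleWeight.comp (measurable_const.prodMk hu)
    exact (Real.measurable_exp.comp
      (((this.sub_const 1).mul_const a).const_mul θ)).aestronglyMeasurable
  · refine Filter.Eventually.of_forall fun ω => ?_
    rw [Real.norm_eq_abs, Real.abs_exp, Real.exp_le_exp]
    refine (le_abs_self _).trans ?_
    rw [abs_mul, abs_mul]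
    gcongr
    refine (abs_sub _ _).trans ?_
    rw [abs_one]
    exact add_le_add (abs_sampleWeight_le _ _) le_rfl

/-- For `0 < r < 1` the weight is `1/r` with probability `r` and `0` otherwise, so it has mean `1`.
The estimate `exp x ≤ 1 + x + x²` at `x = θa/r` leaves the second-order term `θ²a²/r ≤ θ²Ra`. For `r
≥ 1` the weight is almost surely `1`, and for `r ≤ 0` the hypotheses force `a = 0`. -/
theorem integral_exp_sampleWeight_le {u : Ω → ℝ} (hu : Measurable u)
    (hunif : μ.map u = volume.restrict (Set.Icc (0 : ℝ) 1)) {θ a r R : ℝ} (hR : 0 < R)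
    (ha : 0 ≤ a) (har : a ≤ R * r) (hθ : |θ| * R ≤ 1) :
    ∫ ω, Real.exp (θ * ((sampleWeight r (u ω) - 1) * a)) ∂μ ≤ Real.exp (θ ^ 2 * R * a) := by
  have hone : (1 : ℝ) ≤ Real.exp (θ ^ 2 * R * a) := Real.one_le_exp (by positivity)
  rcases le_or_gt r 0 with hr | hr
  · have : a = 0 := le_antisymm (har.trans (mul_nonpos_of_nonneg_of_nonpos hR.le hr)) ha
    simp [this]
  rcases le_or_gt 1 r with hr1 | hr1
  · have hae : ∀ᵐ ω ∂μ, u ω ≤ 1 := by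
      have : ∀ᵐ x ∂(μ.map u), x ≤ 1 := by
        rw [hunif]
        filter_upwards [ae_restrict_mem measurableSet_Icc] with x hx using hx.2
      exact ae_of_ae_map hu.aemeasurable this
    have : ∫ ω, Real.exp (θ * ((sampleWeight r (u ω) - 1) * a)) ∂μ = ∫ _, (1 : ℝ) ∂μ := by
      refine integral_congr_ae ?_
      filter_upwards [hae] with ω hω
      simp [sampleWeight, hω.trans hr1, hr1]
    rw [this]
    simpa using hone
  · have hprob : μ.real {ω | u ω ≤ r} = r := by
      have h1 : μ {ω | u ω ≤ r} = μ.map u (Set.Iic r) :=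
        (Measure.map_apply hu measurableSet_Iic).symm
      have h2 : Set.Iic r ∩ Set.Icc (0 : ℝ) 1 = Set.Icc 0 r := by
        ext x
        simp only [Set.mem_inter_iff, Set.mem_Iic, Set.mem_Icc]
        constructor
        · rintro ⟨h, h', _⟩; exact ⟨h', h⟩
        · rintro ⟨h, h'⟩; exact ⟨h', h, by linarith⟩
      rw [measureReal_def, h1, hunif, Measure.restrict_apply measurableSet_Iic, h2,
        Real.volume_Icc, sub_zero, ENNReal.toReal_ofReal hr.le]
    have hmeas : MeasurableSet {ω | u ω ≤ r} := hu measurableSet_Iic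
    have hsplit : (fun ω => Real.exp (θ * ((sampleWeight r (u ω) - 1) * a))) = fun ω =>
        Real.exp (-(θ * a)) + Set.indicator {ω | u ω ≤ r}
          (fun _ => Real.exp (-(θ * a)) * (Real.exp (θ * a / r) - 1)) ω := by
      funext ω
      by_cases h : u ω ≤ r
      · rw [Set.indicator_of_mem (show ω ∈ {ω | u ω ≤ r} from h), sampleWeight, if_pos h,
          min_eq_right hr1.le, mul_sub, ← Real.exp_add]
        rw [mul_one, add_sub_cancel]
        congr 1
        field_simp
        ring
      · rw [Set.indicator_of_notMem (show ω ∉ {ω | u ω ≤ r} from h), sampleWeight, if_neg h]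
        ring_nf
    rw [hsplit, integral_add (integrable_const _) ((integrable_const _).indicator hmeas),
      integral_indicator_const _ hmeas, hprob]
    simp only [integral_const, probReal_univ, smul_eq_mul, one_mul]
    have hxle : |θ * a / r| ≤ 1 := by
      rw [abs_div, abs_mul, abs_of_nonneg ha, abs_of_pos hr, div_le_one hr]
      nlinarith [mul_le_mul_of_nonneg_left har (abs_nonneg θ)]
    have hexp := (abs_le.1 (Real.abs_exp_sub_one_sub_id_le hxle)).2
    have hsq : r * (θ * a / r) ^ 2 ≤ θ ^ 2 * R * a := by
      have : r * (θ * a / r) ^ 2 = θ ^ 2 * a * (a / r) := by field_simp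
      rw [this, mul_right_comm _ R]
      exact mul_le_mul_of_nonneg_left ((div_le_iff₀ hr).2 har) (by positivity)
    have hra : r * (θ * a / r) = θ * a := by field_simp
    calc Real.exp (-(θ * a)) + r * (Real.exp (-(θ * a)) * (Real.exp (θ * a / r) - 1))
        = Real.exp (-(θ * a)) * (1 + r * (Real.exp (θ * a / r) - 1)) := by ring
      _ ≤ Real.exp (-(θ * a)) * (1 + (θ * a + θ ^ 2 * R * a)) := by
          refine mul_le_mul_of_nonneg_left ?_ (Real.exp_pos _).le
          nlinarith [mul_le_mul_of_nonneg_left hexp hr.le]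
      _ ≤ Real.exp (-(θ * a)) * Real.exp (θ * a + θ ^ 2 * R * a) := by
          refine mul_le_mul_of_nonneg_left ?_ (Real.exp_pos _).le
          linarith [Real.add_one_le_exp (θ * a + θ ^ 2 * R * a)]
      _ = _ := by rw [← Real.exp_add, neg_add_cancel_left]

variable {ι : Type*} [Fintype ι] {u : ι → Ω → ℝ}

theorem mgf_sum_sampleWeight_le (hu : ∀ i, Measurable (u i))
    (hunif : ∀ i, μ.map (u i) = volume.restrict (Set.Icc (0 : ℝ) 1)) (hind : iIndepFun u μ)
    {θ R : ℝ} {a r : ι → ℝ} (hR : 0 < R) (ha : ∀ i, 0 ≤ a i) (hsum : ∑ i, a i = 1)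
    (har : ∀ i, a i ≤ R * r i) (hθ : |θ| * R ≤ 1) :
    Integrable (fun ω => Real.exp (θ * (∑ i, sampleWeight (r i) (u i ω) * a i - 1))) μ ∧
    mgf (fun ω => ∑ i, sampleWeight (r i) (u i ω) * a i - 1) μ θ ≤ Real.exp (θ ^ 2 * R) := by
  let X : ι → Ω → ℝ := fun i ω => (sampleWeight (r i) (u i ω) - 1) * a i
  have hg : ∀ i, Measurable fun x : ℝ => (sampleWeight (r i) x - 1) * a i := fun i =>
    ((measurable_sampleWeight.comp (measurable_const.prodMk measurable_id)).sub_const 1).mul_const _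
  have hX : ∀ i, Measurable (X i) := fun i => (hg i).comp (hu i)
  have hXind : iIndepFun X μ := hind.comp _ hg
  have hEq : (fun ω => ∑ i, sampleWeight (r i) (u i ω) * a i - 1) = ∑ i, X i := by
    funext ω
    simp only [X, Finset.sum_apply, sub_mul, one_mul, Finset.sum_sub_distrib, hsum]
  have hint := hXind.integrable_exp_mul_sum (t := θ) hX (s := Finset.univ)
    fun i _ => integrable_exp_sampleWeight (hu i) θ (a i) (r i)
  have hEq' : ∀ ω, ∑ i, sampleWeight (r i) (u i ω) * a i - 1 = (∑ i, X i) ω := congrFun hEq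
  refine ⟨by simpa only [hEq'] using hint, ?_⟩
  rw [hEq, hXind.mgf_sum hX]
  calc ∏ i, mgf (X i) μ θ ≤ ∏ i, Real.exp (θ ^ 2 * R * a i) :=
        Finset.prod_le_prod (fun i _ => mgf_nonneg) fun i _ =>
          integral_exp_sampleWeight_le (hu i) (hunif i) hR (ha i) (har i) hθ
    _ = _ := by rw [← Real.exp_sum, ← Finset.mul_sum, hsum, mul_one]

theorem measureReal_sampleWeight_deviation_le (hu : ∀ i, Measurable (u i))
    (hunif : ∀ i, μ.map (u i) = volume.restrict (Set.Icc (0 : ℝ) 1)) (hind : iIndepFun u μ)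
    {η R : ℝ} {a r : ι → ℝ} (hR : 0 < R) (ha : ∀ i, 0 ≤ a i) (hsum : ∑ i, a i = 1)
    (har : ∀ i, a i ≤ R * r i) (hη : 0 < η) (hη2 : η ≤ 2) :
    μ.real {ω | η < |∑ i, sampleWeight (r i) (u i ω) * a i - 1|} ≤
      2 * Real.exp (-(η ^ 2 / (4 * R))) := by
  set X : Ω → ℝ := fun ω => ∑ i, sampleWeight (r i) (u i ω) * a i - 1 with hXdef
  -- `θ = η / (2R)` minimizes the Chernoff exponent `-θη + θ²R`.
  have hθ0 : 0 ≤ η / (2 * R) := by positivity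
  have hθ : |η / (2 * R)| * R ≤ 1 := by
    rw [abs_of_nonneg hθ0]; field_simp; exact hη2
  have hval : -(η / (2 * R)) * η + (η / (2 * R)) ^ 2 * R = -(η ^ 2 / (4 * R)) := by
    field_simp; ring
  obtain ⟨hi1, hm1⟩ := mgf_sum_sampleWeight_le hu hunif hind hR ha hsum har hθ
  obtain ⟨hi2, hm2⟩ := mgf_sum_sampleWeight_le (θ := -(η / (2 * R))) hu hunif hind hR ha hsum har
    (by rwa [abs_neg])
  have h1 : μ.real {ω | η ≤ X ω} ≤ Real.exp (-(η ^ 2 / (4 * R))) := by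
    refine (measure_ge_le_exp_mul_mgf η hθ0 hi1).trans ?_
    rw [← hval, Real.exp_add]
    exact mul_le_mul_of_nonneg_left hm1 (Real.exp_pos _).le
  have h2 : μ.real {ω | X ω ≤ -η} ≤ Real.exp (-(η ^ 2 / (4 * R))) := by
    refine (measure_le_le_exp_mul_mgf (-η) (neg_nonpos.2 hθ0) hi2).trans ?_
    rw [← hval, Real.exp_add, neg_neg, mul_neg, ← neg_mul]
    rw [neg_sq] at hm2
    exact mul_le_mul_of_nonneg_left hm2 (Real.exp_pos _).le
  have hsub : {ω | η < |X ω|} ⊆ {ω | η ≤ X ω} ∪ {ω | X ω ≤ -η} := by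
    intro ω hω
    rcases lt_abs.1 (show η < |X ω| from hω) with h | h
    · exact Or.inl h.le
    · exact Or.inr (show X ω ≤ -η by linarith)
  calc _ ≤ μ.real ({ω | η ≤ X ω} ∪ {ω | X ω ≤ -η}) := measureReal_mono hsub
    _ ≤ _ := (measureReal_union_le _ _).trans (by linarith)

end Concentration

/-! ### Failure probability on a net -/

/-- The least admissible constant in the sampling probabilities. -/
def minSampleConst (p : ℝ) : ℝ := 4 * (24 * p) ^ 2 * (2 + Real.log (72 * p) / Real.log 2)

theorem minSampleConst_pos {p : ℝ} (hp : 1 ≤ p) : 0 < minSampleConst p := by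
  have h1 : 0 ≤ Real.log (72 * p) := Real.log_nonneg (by linarith)
  have h2 : 0 < Real.log 2 := Real.log_pos one_lt_two
  unfold minSampleConst
  positivity

/-- The logarithmic factor `d log (d / ε) + log (1 / δ)`. -/
def logFactor (d : ℕ) (ε δ : ℝ) : ℝ := d * Real.log (d / ε) + Real.log (1 / δ)

theorem logFactor_pos (d : ℕ) {ε δ : ℝ} (hε : 0 < ε) (hε1 : ε < 1) (hδ : 0 < δ) (hδ1 : δ < 1) :
    0 < logFactor d ε δ := by
  have h1 : 0 < Real.log (1 / δ) := Real.log_pos ((one_lt_div hδ).2 hδ1)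
  have h2 : 0 ≤ d * Real.log (d / ε) := by
    rcases Nat.eq_zero_or_pos d with rfl | hd
    · simp
    · have : (1 : ℝ) ≤ d := by exact_mod_cast hd
      exact mul_nonneg (by positivity) (Real.log_nonneg ((one_le_div hε).2 (by linarith)))
  unfold logFactor
  linarith

/-- For `d ≥ 2` the first bound comes from `d log d`. This term vanishes for `d = 1`, where `log
(1/(εδ)) ≥ log 2` has to replace it. -/
theorem logFactor_bounds {d : ℕ} (hd : d ≠ 0) {ε δ : ℝ} (hε : 0 < ε) (hε1 : ε < 1) (hδ : 0 < δ)
    (hδ1 : δ < 1) (h1 : d = 1 → ε * δ ≤ 1 / 2) :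
    d * Real.log 2 ≤ logFactor d ε δ ∧
      -(d * Real.log ε) - Real.log δ ≤ logFactor d ε δ := by
  have hd1 : (1 : ℝ) ≤ d := by exact_mod_cast Nat.one_le_iff_ne_zero.2 hd
  have hlε : Real.log ε < 0 := Real.log_neg hε hε1
  have hlδ : Real.log δ < 0 := Real.log_neg hδ hδ1
  have hld : 0 ≤ Real.log d := Real.log_nonneg hd1
  have hL : logFactor d ε δ = d * Real.log d - d * Real.log ε - Real.log δ := by
    rw [logFactor, Real.log_div (by positivity) hε.ne', one_div, Real.log_inv]
    ring
  rw [hL]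
  have h0 : 0 ≤ d * Real.log d := by positivity
  have h0' : d * Real.log ε ≤ 0 := by nlinarith
  refine ⟨?_, by linarith⟩
  rcases eq_or_ne d 1 with rfl | hne
  · have h2 : Real.log (ε * δ) ≤ Real.log (1 / 2) := Real.log_le_log (by positivity) (h1 rfl)
    rw [Real.log_mul hε.ne' hδ.ne', one_div, Real.log_inv] at h2
    simp only [Nat.cast_one, Real.log_one]
    linarith
  · have hd2 : (2 : ℝ) ≤ d := by
      exact_mod_cast (show 2 ≤ d by omega)
    have := mul_le_mul_of_nonneg_left (Real.log_le_log two_pos hd2) (by positivity : (0 : ℝ) ≤ d)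
    linarith

/-- This is the computation that dictates `minSampleConst`. With `L` the logarithmic factor, the
Chernoff exponent is at least `(2 + log (72p) / log 2) L`. One `L` pays for the factor `2`, one for
`ε^(-d)` and the target `δ`, and the rest for `(72p)^d`, because `L ≥ d log 2`. -/
theorem net_failure_le {p C ε δ : ℝ} (hp : 1 ≤ p) (hC : minSampleConst p ≤ C) {d : ℕ} (hd : d ≠ 0)
    (hε : 0 < ε) (hε1 : ε < 1) (hδ : 0 < δ) (hδ1 : δ < 1) (h1 : d = 1 → ε * δ ≤ 1 / 2) :
    (3 / (ε / (24 * p))) ^ d * (2 * Real.exp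
      (-((ε / (24 * p)) ^ 2 / (4 * (ε ^ 2 / (C * logFactor d ε δ)))))) ≤ δ := by
  have hp0 : 0 < p := by linarith
  have hL := logFactor_pos d hε hε1 hδ hδ1
  obtain ⟨hb1, hb2⟩ := logFactor_bounds hd hε hε1 hδ hδ1 h1
  set L := logFactor d ε δ
  have hl2 : 0 < Real.log 2 := Real.log_pos one_lt_two
  have hC0 : 0 < C := (minSampleConst_pos hp).trans_le hC
  have hlp : 0 ≤ Real.log (72 * p) := Real.log_nonneg (by linarith)
  have hd1 : (1 : ℝ) ≤ d := by exact_mod_cast Nat.one_le_iff_ne_zero.2 hd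
  have hexp : (2 + Real.log (72 * p) / Real.log 2) * L ≤
      (ε / (24 * p)) ^ 2 / (4 * (ε ^ 2 / (C * L))) := by
    have : (ε / (24 * p)) ^ 2 / (4 * (ε ^ 2 / (C * L))) = C * L / (4 * (24 * p) ^ 2) := by
      field_simp
    rw [this, le_div_iff₀ (by positivity)]
    have := mul_le_mul_of_nonneg_right hC hL.le
    unfold minSampleConst at this
    linarith
  have hpow : (3 / (ε / (24 * p))) ^ d = Real.exp (d * (Real.log (72 * p) - Real.log ε)) := by
    rw [← Real.log_div (by positivity) hε.ne', mul_comm (d : ℝ), Real.exp_mul,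
      Real.exp_log (by positivity), Real.rpow_natCast]
    congr 1
    field_simp
    norm_num
  have h2 : ∀ x, 2 * Real.exp (-x) = Real.exp (Real.log 2 - x) := fun x => by
    rw [sub_eq_add_neg, Real.exp_add, Real.exp_log two_pos]
  rw [hpow, h2, ← Real.exp_add, ← Real.le_log_iff_exp_le hδ]
  have h3 : d * Real.log (72 * p) ≤ Real.log (72 * p) / Real.log 2 * L := by
    rw [div_mul_eq_mul_div, le_div_iff₀ hl2]
    nlinarith
  nlinarith

/-! ### Union bound over the net -/

section Embedding

variable {Ω : Type*} [MeasurableSpace Ω] {μ : Measure Ω} [IsProbabilityMeasure μ]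
  {ι : Type*} [Fintype ι] {u : ι → Ω → ℝ}

theorem measureReal_net_failure_le (hu : ∀ i, Measurable (u i))
    (hunif : ∀ i, μ.map (u i) = volume.restrict (Set.Icc (0 : ℝ) 1)) (hind : iIndepFun u μ)
    {p C ε δ : ℝ} (hp : 1 ≤ p) (hC : minSampleConst p ≤ C) {d : ℕ} (hε : 0 < ε) (hε1 : ε < 1)
    (hδ : 0 < δ) (hδ1 : δ < 1) (h1 : d = 1 → ε * δ ≤ 1 / 2) [Fact (1 ≤ ENNReal.ofReal p)]
    (W : Submodule ℝ (PiLp (ENNReal.ofReal p) fun _ : ι => ℝ)) (hW : Module.finrank ℝ W ≤ d)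
    (s : Finset W) (hs : ∀ y ∈ s, ‖y‖ = 1)
    (hcard : (s.card : ℝ) ≤ (3 / (ε / (24 * p))) ^ Module.finrank ℝ W) {r : ι → ℝ}
    (hr : ∀ y ∈ W, ∀ i, |y i| ^ p ≤
      ε ^ 2 / (C * logFactor d ε δ) * r i * lpPow p y.ofLp) :
    μ.real {ω | ∃ y ∈ s, ε / (24 * p) <
      |∑ i, sampleWeight (r i) (u i ω) * |y.1 i| ^ p - 1|} ≤ δ := by
  have hp0 : 0 < p := by linarith
  rcases eq_or_ne d 0 with rfl | hd
  -- The zero space has no unit vectors, so there is nothing to test.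
  · have hsub : Subsingleton W := Module.finrank_zero_iff.1 (Nat.le_zero.1 hW)
    have : {ω | ∃ y ∈ s, ε / (24 * p) <
        |∑ i, sampleWeight (r i) (u i ω) * |y.1 i| ^ p - 1|} = ∅ := by
      refine Set.eq_empty_of_forall_notMem fun ω ⟨y, hy, _⟩ => ?_
      have := hs y hy
      rw [Subsingleton.elim y 0, norm_zero] at this
      exact zero_ne_one this
    rw [this, measureReal_empty]
    exact hδ.le
  have hR : 0 < ε ^ 2 / (C * logFactor d ε δ) :=
    div_pos (by positivity) (mul_pos ((minSampleConst_pos hp).trans_le hC)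
      (logFactor_pos d hε hε1 hδ hδ1))
  have hη : 0 < ε / (24 * p) := by positivity
  have hη1 : ε / (24 * p) ≤ 1 := by
    rw [div_le_one (by positivity)]; linarith
  have hset : {ω | ∃ y ∈ s, ε / (24 * p) <
      |∑ i, sampleWeight (r i) (u i ω) * |y.1 i| ^ p - 1|} = ⋃ y ∈ s, {ω | ε / (24 * p) <
      |∑ i, sampleWeight (r i) (u i ω) * |y.1 i| ^ p - 1|} := by
    ext ω; simp
  rw [hset]
  refine (measureReal_biUnion_finset_le s _).trans ?_
  have hone : ∀ y ∈ s, lpPow p y.1.ofLp = 1 := by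
    intro y hy
    rw [← norm_rpow_eq_lpPow hp0, Submodule.norm_coe, hs y hy, Real.one_rpow]
  calc _ ≤ ∑ _y ∈ s, 2 * Real.exp (-((ε / (24 * p)) ^ 2 /
          (4 * (ε ^ 2 / (C * logFactor d ε δ))))) := by
        refine Finset.sum_le_sum fun y hy => ?_
        refine measureReal_sampleWeight_deviation_le hu hunif hind hR (fun i => by positivity)
          (hone y hy) (fun i => ?_) hη (by linarith)
        have := hr y.1 y.2 i
        rwa [hone y hy, mul_one] at this
    _ = s.card * (2 * Real.exp (-((ε / (24 * p)) ^ 2 /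
          (4 * (ε ^ 2 / (C * logFactor d ε δ)))))) := by rw [Finset.sum_const, nsmul_eq_mul]
    _ ≤ (3 / (ε / (24 * p))) ^ d * (2 * Real.exp (-((ε / (24 * p)) ^ 2 /
          (4 * (ε ^ 2 / (C * logFactor d ε δ)))))) := by
        refine mul_le_mul_of_nonneg_right (hcard.trans ?_) (by positivity)
        refine pow_le_pow_right₀ ?_ hW
        rw [le_div_iff₀ hη]
        linarith
    _ ≤ δ := net_failure_le hp hC hd hε hε1 hδ hδ1 h1

end Embedding

/-! ### Sensitivities -/

section Sensitivity

variable {n : Type*} [Fintype n] {d : ℕ} {p : ℝ}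

theorem lpPow_nonneg (p : ℝ) (y : n → ℝ) : 0 ≤ lpPow p y :=
  Finset.sum_nonneg fun _ _ => by positivity

theorem lpPow_zero (hp : 0 < p) : lpPow p (0 : n → ℝ) = 0 := by
  simp [lpPow, Real.zero_rpow hp.ne']

theorem lpPow_eq_zero_iff (hp : 0 < p) {y : n → ℝ} : lpPow p y = 0 ↔ y = 0 := by
  refine ⟨fun h => funext fun i => ?_, fun h => h ▸ lpPow_zero hp⟩
  have := (Finset.sum_eq_zero_iff_of_nonneg fun _ _ => by positivity).1 h i (Finset.mem_univ i)
  exact abs_eq_zero.1 ((Real.rpow_eq_zero (abs_nonneg _) hp.ne').1 this)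

theorem sensitivity_nonneg (p : ℝ) (M : Matrix n (Fin d) ℝ) (a : Fin d → ℝ) :
    0 ≤ sensitivity p M a := by
  refine Real.sSup_nonneg ?_
  rintro _ ⟨x, -, rfl⟩
  exact div_nonneg (by positivity) (lpPow_nonneg _ _)

theorem sensitivity_le (hp : 0 < p) {M : Matrix n (Fin d) ℝ} {a : Fin d → ℝ} {B : ℝ} (hB : 0 ≤ B)
    (h : ∀ x, |a ⬝ᵥ x| ^ p ≤ B * lpPow p (M.mulVec x)) : sensitivity p M a ≤ B := by
  refine Real.sSup_le ?_ hB
  rintro _ ⟨x, hx, rfl⟩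
  have : 0 < lpPow p (M.mulVec x) :=
    (lpPow_nonneg _ _).lt_of_ne fun h0 => hx ((lpPow_eq_zero_iff hp).1 h0.symm)
  exact (div_le_iff₀ this).2 (h x)

/-- Some finite `B` is needed: it bounds the set, so that `sSup` is not the default `0`, and it
makes `a` vanish on the kernel of `M`. -/
theorem le_sensitivity_mul (hp : 0 < p) {M : Matrix n (Fin d) ℝ} {a : Fin d → ℝ} {B : ℝ}
    (h : ∀ x, |a ⬝ᵥ x| ^ p ≤ B * lpPow p (M.mulVec x)) (x : Fin d → ℝ) :
    |a ⬝ᵥ x| ^ p ≤ sensitivity p M a * lpPow p (M.mulVec x) := by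
  have hpos : ∀ {x : Fin d → ℝ}, M.mulVec x ≠ 0 → 0 < lpPow p (M.mulVec x) := fun {x} hx =>
    (lpPow_nonneg _ _).lt_of_ne fun h0 => hx ((lpPow_eq_zero_iff hp).1 h0.symm)
  by_cases hx : M.mulVec x = 0
  · have := h x
    rw [hx, lpPow_zero hp, mul_zero] at this ⊢
    exact this
  · rw [← div_le_iff₀ (hpos hx)]
    refine le_csSup ⟨B, ?_⟩ ⟨x, hx, rfl⟩
    rintro _ ⟨z, hz, rfl⟩
    exact (div_le_iff₀ (hpos hz)).2 (h z)

/-- The supremum in the definition of the sensitivity may be taken over rational vectors. -/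
theorem sensitivity_eq_iSup_rat (hp : 0 < p) {M : Matrix n (Fin d) ℝ} {a : Fin d → ℝ} {B : ℝ}
    (h : ∀ x, |a ⬝ᵥ x| ^ p ≤ B * lpPow p (M.mulVec x)) :
    sensitivity p M a = ⨆ x : Fin d → ℚ,
      |a ⬝ᵥ fun i => (x i : ℝ)| ^ p / lpPow p (M.mulVec fun i => (x i : ℝ)) := by
  -- Rational `x` in the kernel of `M` are harmless: division by `0` gives `0`.
  have hle : ∀ x : Fin d → ℚ, |a ⬝ᵥ fun i => (x i : ℝ)| ^ p /
      lpPow p (M.mulVec fun i => (x i : ℝ)) ≤ sensitivity p M a := fun x =>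
    div_le_of_le_mul₀ (lpPow_nonneg _ _) (sensitivity_nonneg _ _ _) (le_sensitivity_mul hp h _)
  refine le_antisymm ?_ (ciSup_le hle)
  refine sensitivity_le hp (Real.iSup_nonneg fun x =>
    div_nonneg (by positivity) (lpPow_nonneg _ _)) ?_
  have hdense : DenseRange fun (x : Fin d → ℚ) (i : Fin d) => (x i : ℝ) :=
    DenseRange.piMap fun _ => Rat.denseRange_cast
  intro x
  refine hdense.induction_on (p := fun x => |a ⬝ᵥ x| ^ p ≤ _ * lpPow p (M.mulVec x)) x ?_ ?_
  · have hcont : ∀ b : Fin d → ℝ, Continuous fun x : Fin d → ℝ => |b ⬝ᵥ x| ^ p := fun b =>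
      (continuous_abs.comp (continuous_const.dotProduct continuous_id)).rpow_const
        fun _ => Or.inr hp.le
    exact isClosed_le (hcont a)
      (continuous_const.mul (continuous_finsetSum _ fun i _ => hcont (M i)))
  · intro x
    by_cases hx : M.mulVec (fun i => (x i : ℝ)) = 0
    · have := h fun i => (x i : ℝ)
      rw [hx, lpPow_zero hp, mul_zero] at this ⊢
      exact this
    · have hpos : 0 < lpPow p (M.mulVec fun i => (x i : ℝ)) :=
        (lpPow_nonneg _ _).lt_of_ne fun h0 => hx ((lpPow_eq_zero_iff hp).1 h0.symm)
      rw [← div_le_iff₀ hpos]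
      refine le_ciSup (f := fun x : Fin d → ℚ => |a ⬝ᵥ fun i => (x i : ℝ)| ^ p /
        lpPow p (M.mulVec fun i => (x i : ℝ))) ⟨sensitivity p M a, ?_⟩ x
      rintro _ ⟨z, rfl⟩
      exact hle z

/-- Matrices with almost equal norms have almost equal sensitivities. -/
theorem sensitivity_bounds_of_lpPow_bounds {n' : Type*} [Fintype n'] (hp : 0 < p)
    {A : Matrix n (Fin d) ℝ} {M : Matrix n' (Fin d) ℝ} {a : Fin d → ℝ} {ε : ℝ} (hε : 0 < ε)
    (hε1 : ε < 1) {B : ℝ} (ha : ∀ x, |a ⬝ᵥ x| ^ p ≤ B * lpPow p (A.mulVec x))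
    (hlow : ∀ x, (1 - ε / 4) * lpPow p (A.mulVec x) ≤ lpPow p (M.mulVec x))
    (hupp : ∀ x, lpPow p (M.mulVec x) ≤ (1 + ε / 4) * lpPow p (A.mulVec x)) :
    sensitivity p A a ≤ (1 + ε / 4) * sensitivity p M a ∧
      (1 + ε / 4) * sensitivity p M a ≤ (1 + ε) * sensitivity p A a ∧
      ∀ x, |a ⬝ᵥ x| ^ p ≤
        sensitivity p A a / (1 - ε / 4) * lpPow p (M.mulVec x) := by
  have hA := sensitivity_nonneg p A a
  have hM := sensitivity_nonneg p M a
  have h1 : 0 < 1 - ε / 4 := by linarith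
  have hMa : ∀ x, |a ⬝ᵥ x| ^ p ≤ sensitivity p A a / (1 - ε / 4) * lpPow p (M.mulVec x) := by
    intro x
    refine (le_sensitivity_mul hp ha x).trans ?_
    rw [div_mul_eq_mul_div, le_div_iff₀ h1, mul_assoc, mul_comm (lpPow p _)]
    exact mul_le_mul_of_nonneg_left (hlow x) hA
  refine ⟨?_, ?_, hMa⟩
  · refine sensitivity_le hp (by positivity) fun x => (le_sensitivity_mul hp hMa x).trans ?_
    rw [mul_comm (1 + ε / 4), mul_assoc]
    exact mul_le_mul_of_nonneg_left (hupp x) hM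
  · have h2 : sensitivity p M a ≤ sensitivity p A a / (1 - ε / 4) :=
      sensitivity_le hp (by positivity) hMa
    rw [le_div_iff₀ h1] at h2
    -- This rests on `1 + ε/4 ≤ (1 + ε)(1 - ε/4)`.
    nlinarith [mul_nonneg hA hε.le, mul_nonneg hM hε.le, mul_nonneg (mul_nonneg hM hε.le) hε.le]

end Sensitivity

/-! ### Sensitivities within a dataset -/

theorem lpPow_vals {T : Type*} {d : ℕ} (p : ℝ) (A : Items T d) (x : Fin d → ℝ) :
    lpPow p ((vals A).mulVec x) = ∑ a ∈ A, |a.2 ⬝ᵥ x| ^ p :=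
  Finset.sum_coe_sort A fun a => |a.2 ⬝ᵥ x| ^ p

theorem abs_dotProduct_le_lpPow_vals {T : Type*} {d : ℕ} (p : ℝ) {A : Items T d}
    {a : T × (Fin d → ℝ)} (ha : a ∈ A) (x : Fin d → ℝ) :
    |a.2 ⬝ᵥ x| ^ p ≤ 1 * lpPow p ((vals A).mulVec x) := by
  rw [one_mul, lpPow_vals]
  exact Finset.single_le_sum (f := fun a : T × (Fin d → ℝ) => |a.2 ⬝ᵥ x| ^ p)
    (fun _ _ => by positivity) ha

/-- Further rows only enlarge the denominator. This is why probabilities chosen for one dataset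
still suffice in the union. -/
theorem sensitivity_vals_anti {T : Type*} {d : ℕ} {p : ℝ} (hp : 0 < p) {A B : Items T d}
    (hAB : A ⊆ B) {a : T × (Fin d → ℝ)} (ha : a ∈ A) :
    sensitivity p (vals B) a.2 ≤ sensitivity p (vals A) a.2 := by
  refine sensitivity_le hp (sensitivity_nonneg _ _ _) fun x =>
    (le_sensitivity_mul hp (abs_dotProduct_le_lpPow_vals p ha) x).trans
      (mul_le_mul_of_nonneg_left ?_ (sensitivity_nonneg _ _ _))
  rw [lpPow_vals, lpPow_vals]
  exact Finset.sum_le_sum_of_subset_of_nonneg hAB fun _ _ _ => by positivity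

/-! ### Unions of samples -/

section Union

variable {T : Type*} {d s : ℕ} {P : SketchParams} {A : Fin s → Items T d}

theorem mem_unionItems {a : T × (Fin d → ℝ)} : a ∈ unionItems A ↔ ∃ j, a ∈ A j := by
  simp [unionItems]

theorem isDataset_unionItems (hA : ∀ i j, Conforming (A i) (A j)) : IsDataset (unionItems A) := by
  intro a ha b hb
  obtain ⟨i, hi⟩ := mem_unionItems.1 ha
  obtain ⟨j, hj⟩ := mem_unionItems.1 hb
  exact hA i j a hi b hj

/-- The largest sampling probability of an item among the datasets that contain it. -/
def unionProb (P : SketchParams) (A : Fin s → Items T d) (τ : Fin s → T → ℝ)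
    (a : T × (Fin d → ℝ)) : ℝ :=
  ⨆ j : {j // a ∈ A j}, sampleProb P d (τ j a.1)

theorem sampleProb_le_unionProb (P : SketchParams) (τ : Fin s → T → ℝ) {a : T × (Fin d → ℝ)}
    {j : Fin s} (hj : a ∈ A j) : sampleProb P d (τ j a.1) ≤ unionProb P A τ a :=
  le_ciSup (f := fun j : {j // a ∈ A j} => sampleProb P d (τ j a.1))
    (Set.finite_range _).bddAbove ⟨j, hj⟩

theorem exists_sampleProb_eq_unionProb (P : SketchParams) (τ : Fin s → T → ℝ)
    {a : T × (Fin d → ℝ)} (ha : a ∈ unionItems A) :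
    ∃ j, a ∈ A j ∧ sampleProb P d (τ j a.1) = unionProb P A τ a := by
  obtain ⟨j, hj⟩ := mem_unionItems.1 ha
  have : Nonempty {j // a ∈ A j} := ⟨⟨j, hj⟩⟩
  obtain ⟨⟨i, hi⟩, h⟩ := exists_eq_ciSup_of_finite
    (f := fun j : {j // a ∈ A j} => sampleProb P d (τ j a.1))
  exact ⟨i, hi, h⟩

open scoped Classical in
/-- The union of the samples of several datasets with the same hash function. -/
def unionSample (P : SketchParams) (A : Fin s → Items T d) (h : T → ℝ) (τ : Fin s → T → ℝ) :
    Tuples T d :=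
  Finset.univ.biUnion fun j => senSample P (A j) h (τ j)

theorem mem_unionSample {h : T → ℝ} {τ : Fin s → T → ℝ} {k : T} {v : Fin d → ℝ} {q : ℝ} :
    (k, v, q) ∈ unionSample P A h τ ↔
      ∃ j, (k, v) ∈ A j ∧ h k ≤ sampleProb P d (τ j k) ∧ q = min (sampleProb P d (τ j k)) 1 := by
  simp only [unionSample, senSample, Finset.mem_biUnion, Finset.mem_univ, true_and,
    Finset.mem_image, Finset.mem_filter]
  refine exists_congr fun j => ⟨?_, fun ⟨h1, h2, h3⟩ => ⟨(k, v), ⟨h1, h2⟩, by simp [h3]⟩⟩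
  rintro ⟨⟨k', v'⟩, ⟨h1, h2⟩, h3⟩
  simp only [Prod.mk.injEq] at h3
  obtain ⟨rfl, rfl, rfl⟩ := h3
  exact ⟨h1, h2, rfl⟩

/-- The hash value is shared by all datasets, and it is below one of finitely many thresholds iff it
is below the largest. -/
theorem mem_sampledItems_unionSample {h : T → ℝ} {τ : Fin s → T → ℝ} {a : T × (Fin d → ℝ)} :
    a ∈ sampledItems (unionSample P A h τ) ↔ a ∈ unionItems A ∧ h a.1 ≤ unionProb P A τ a := by
  have hmem : a ∈ sampledItems (unionSample P A h τ) ↔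
      ∃ q, (a.1, a.2, q) ∈ unionSample P A h τ := by
    simp only [sampledItems, Finset.mem_image]
    constructor
    · rintro ⟨⟨k, v, q⟩, hu, rfl⟩
      exact ⟨q, hu⟩
    · rintro ⟨q, hq⟩
      exact ⟨_, hq, rfl⟩
  rw [hmem]
  constructor
  · rintro ⟨q, hq⟩
    obtain ⟨j, hj, hh, -⟩ := mem_unionSample.1 hq
    exact ⟨mem_unionItems.2 ⟨j, hj⟩, hh.trans (sampleProb_le_unionProb P τ hj)⟩
  · rintro ⟨ha, hh⟩
    obtain ⟨j, hj, he⟩ := exists_sampleProb_eq_unionProb P τ ha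
    exact ⟨_, mem_unionSample.2 ⟨j, hj, hh.trans he.ge, rfl⟩⟩

/-- If any threshold admits the item, so does the largest; hence its value is among those stored,
and the algorithm can read it off. -/
theorem maxProb_unionSample {h : T → ℝ} {τ : Fin s → T → ℝ} {a : T × (Fin d → ℝ)}
    (ha : a ∈ sampledItems (unionSample P A h τ)) :
    maxProb (unionSample P A h τ) a = min 1 (unionProb P A τ a) := by
  obtain ⟨ha, hh⟩ := mem_sampledItems_unionSample.1 ha
  obtain ⟨j, hj, he⟩ := exists_sampleProb_eq_unionProb P τ ha
  refine IsGreatest.csSup_eq ⟨mem_unionSample.2 ⟨j, hj, hh.trans he.ge, ?_⟩, ?_⟩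
  · rw [he, min_comm]
  · rintro q hq
    obtain ⟨i, hi, -, rfl⟩ := mem_unionSample.1 hq
    rw [min_comm]
    exact min_le_min_left _ (sampleProb_le_unionProb P τ hi)

theorem lpPow_sampledMatrix_unionSample {p : ℝ} (hp : 0 < p) {h : T → ℝ} {τ : Fin s → T → ℝ}
    (hnn : ∀ a ∈ unionItems A, 0 ≤ unionProb P A τ a) (x : Fin d → ℝ) :
    lpPow p ((sampledMatrix p (unionSample P A h τ)).mulVec x) =
      ∑ a : unionItems A, sampleWeight (unionProb P A τ a.1) (h a.1.1) * |a.1.2 ⬝ᵥ x| ^ p := by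
  classical
  have h1 : sampledItems (unionSample P A h τ) =
      (unionItems A).filter fun a => h a.1 ≤ unionProb P A τ a := by
    ext a
    rw [mem_sampledItems_unionSample, Finset.mem_filter]
  rw [Finset.sum_coe_sort (unionItems A) fun a =>
    sampleWeight (unionProb P A τ a) (h a.1) * |a.2 ⬝ᵥ x| ^ p]
  have h2 : lpPow p ((sampledMatrix p (unionSample P A h τ)).mulVec x) =
      ∑ a : sampledItems (unionSample P A h τ),
        1 / min 1 (unionProb P A τ a.1) * |a.1.2 ⬝ᵥ x| ^ p := by
    refine Finset.sum_congr rfl fun a _ => ?_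
    have hq : 0 ≤ 1 / min 1 (unionProb P A τ a.1) := by
      have := hnn _ (mem_sampledItems_unionSample.1 a.2).1
      positivity
    have : (sampledMatrix p (unionSample P A h τ)).mulVec x a =
        (1 / min 1 (unionProb P A τ a.1)) ^ (1 / p) * (a.1.2 ⬝ᵥ x) := by
      rw [← maxProb_unionSample a.2, ← smul_eq_mul, ← smul_dotProduct]
      rfl
    rw [this, abs_mul, abs_of_nonneg (Real.rpow_nonneg hq _),
      Real.mul_rpow (Real.rpow_nonneg hq _) (abs_nonneg _), ← Real.rpow_mul hq,
      one_div_mul_cancel hp.ne', Real.rpow_one]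
  rw [h2, Finset.sum_coe_sort (sampledItems (unionSample P A h τ)) fun a =>
    1 / min 1 (unionProb P A τ a) * |a.2 ⬝ᵥ x| ^ p, h1, Finset.sum_filter]
  refine Finset.sum_congr rfl fun a _ => ?_
  unfold sampleWeight
  split_ifs <;> simp

/-- Merging the samples of several datasets yields the samples of their union if the new sampling
probabilities do not exceed the old ones. -/
theorem mergeSketches_senSample {m : ℕ} {t : Fin s → ℕ} (hm : ∀ j, m + 1 ≤ t j) (h : ℕ → T → ℝ)
    (τ : Fin s → T → ℝ) (τ' : T → ℝ)
    (hτ' : ∀ a ∈ unionItems A, τ' a.1 = (1 + P.ε) ^ m * (1 + P.ε / 4) *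
      sensitivity P.p (sampledMatrix P.p (unionSample P A (h m) τ)) a.2)
    (hle : ∀ a ∈ unionItems A, sampleProb P d (τ' a.1) ≤ unionProb P A τ a) :
    mergeSketches P h hm (fun j (i : Fin (t j)) => senSample P (A j) (h i) (τ j)) =
      some fun i : Fin m => senSample P (unionItems A) (h i) τ' := by
  classical
  obtain ⟨S, hS⟩ : ∃ S : ∀ j, Sketch T d (t j), S = fun j (i : Fin (t j)) =>
    senSample P (A j) (h i) (τ j) := ⟨_, rfl⟩
  have hcopy : ∀ i : Fin (m + 1), copyUnion hm S i = unionSample P A (h i) τ := fun i => by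
    simp only [hS, copyUnion, unionSample, Fin.val_castLE]
  have hlast : copyUnion hm S (Fin.last m) = unionSample P A (h m) τ := hcopy _
  have hprob : ∀ a ∈ unionItems A, sampleProb P d ((1 + P.ε) ^ m * (1 + P.ε / 4) *
      sensitivity P.p (sampledMatrix P.p (copyUnion hm S (Fin.last m))) a.2) =
        sampleProb P d (τ' a.1) := fun a ha => by rw [hlast, hτ' a ha]
  rw [← hS]
  unfold mergeSketches
  simp only [fun i : Fin m => hcopy i.castSucc, Fin.val_castSucc]
  rw [if_neg]
  · congr 1
    funext i
    ext ⟨k, v, q⟩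
    simp only [senSample, Finset.mem_image, Finset.mem_filter, mem_sampledItems_unionSample]
    refine exists_congr fun a => ?_
    constructor
    · rintro ⟨⟨⟨ha, -⟩, h2⟩, h3⟩
      rw [hprob a ha] at h2 h3
      exact ⟨⟨ha, h2⟩, by rw [← h3, min_comm]⟩
    · rintro ⟨⟨ha, h2⟩, h3⟩
      rw [hprob a ha]
      -- An item that the new probability selects was selected by the larger old one, so resampling
      -- misses nothing.
      exact ⟨⟨⟨ha, h2.trans (hle a ha)⟩, h2⟩, by rw [← h3, min_comm]⟩
  · rintro ⟨i, a, ha, hlt⟩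
    have haU := (mem_sampledItems_unionSample.1 ha).1
    rw [maxProb_unionSample ha, hprob a haU] at hlt
    exact hlt.not_ge (min_le_min_left _ (hle a haU))

end Union

/-! ### Independence of the side randomness -/

theorem measurable_hashSigma {Ω T : Type*} (h : ℕ → T → Ω → ℝ) {I : Set ℕ} {i : ℕ} (hi : i ∈ I) (k : T) :
    Measurable[hashSigma h I] (h i k) :=
  Measurable.of_comap_le ((le_iSup (fun k => MeasurableSpace.comap (h i k) inferInstance) k).trans
    (le_iSup₂ (f := fun i _ => ⨆ k, MeasurableSpace.comap (h i k) inferInstance) i hi))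

section Independence

variable {Ω T : Type*} [mΩ : MeasurableSpace Ω] {μ : Measure Ω}

theorem hashSigma_le {h : ℕ → T → Ω → ℝ} (hh : IsRandomHash μ h) (I : Set ℕ) :
    hashSigma h I ≤ mΩ :=
  iSup₂_le fun i _ => iSup_le fun k => (hh.measurable i k).comap_le

theorem indep_hashSigma {h : ℕ → T → Ω → ℝ} (hh : IsRandomHash μ h) {I J : Set ℕ}
    (hIJ : Disjoint I J) : Indep (hashSigma h I) (hashSigma h J) μ := by
  have key := indep_iSup_of_disjoint
    (m := fun ik : ℕ × T => MeasurableSpace.comap (h ik.1 ik.2) inferInstance)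
    (fun ik => (hh.measurable ik.1 ik.2).comap_le) hh.indep
    (S := I ×ˢ Set.univ) (T := J ×ˢ Set.univ) (Set.disjoint_prod.2 (Or.inl hIJ))
  have hle : ∀ K : Set ℕ, hashSigma h K ≤ ⨆ ik ∈ K ×ˢ (Set.univ : Set T),
      MeasurableSpace.comap (h ik.1 ik.2) inferInstance := fun K =>
    iSup₂_le fun i hi => iSup_le fun k =>
      le_iSup₂ (f := fun (ik : ℕ × T) (_ : ik ∈ K ×ˢ (Set.univ : Set T)) =>
        MeasurableSpace.comap (h ik.1 ik.2) inferInstance) (i, k) ⟨hi, trivial⟩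
  exact indep_of_indep_of_le_left (indep_of_indep_of_le_right key (hle J)) (hle I)

/-- If `m₁` is independent of `m₂ ⊔ m₃` and `m₂` of `m₃`, then `m₁ ⊔ m₂` is independent of `m₃`. -/
theorem indep_sup_left_of_indep_sup_right [IsProbabilityMeasure μ] {m₁ m₂ m₃ : MeasurableSpace Ω}
    (h₁ : m₁ ≤ mΩ) (h₂ : m₂ ≤ mΩ) (h₃ : m₃ ≤ mΩ) (h : Indep m₁ (m₂ ⊔ m₃) μ) (h' : Indep m₂ m₃ μ) :
    Indep (m₁ ⊔ m₂) m₃ μ := by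
  -- The intersections `a ∩ b` form a π-system generating `m₁ ⊔ m₂`, so the product formula is
  -- needed only for them.
  let π : Set (Set Ω) := {u | ∃ a b, MeasurableSet[m₁] a ∧ MeasurableSet[m₂] b ∧ u = a ∩ b}
  have hπ : IsPiSystem π := by
    rintro _ ⟨a, b, ha, hb, rfl⟩ _ ⟨a', b', ha', hb', rfl⟩ -
    exact ⟨a ∩ a', b ∩ b', ha.inter ha', hb.inter hb', Set.inter_inter_inter_comm _ _ _ _⟩
  have hgen : m₁ ⊔ m₂ = MeasurableSpace.generateFrom π := by
    refine le_antisymm (sup_le ?_ ?_) (MeasurableSpace.generateFrom_le ?_)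
    · exact fun a ha => MeasurableSpace.measurableSet_generateFrom
        ⟨a, Set.univ, ha, MeasurableSet.univ, (Set.inter_univ a).symm⟩
    · exact fun b hb => MeasurableSpace.measurableSet_generateFrom
        ⟨Set.univ, b, MeasurableSet.univ, hb, (Set.univ_inter b).symm⟩
    · rintro _ ⟨a, b, ha, hb, rfl⟩
      exact MeasurableSet.inter ((le_sup_left : m₁ ≤ m₁ ⊔ m₂) a ha)
        ((le_sup_right : m₂ ≤ m₁ ⊔ m₂) b hb)
  refine IndepSets.indep (p1 := π) (p2 := {c | MeasurableSet[m₃] c}) (sup_le h₁ h₂) h₃ hπ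
    (@MeasurableSpace.isPiSystem_measurableSet Ω m₃) hgen
    (@MeasurableSpace.generateFrom_measurableSet Ω m₃).symm ?_
  rw [IndepSets_iff]
  rintro _ c ⟨a, b, ha, hb, rfl⟩ hc
  have hb' := (le_sup_left : m₂ ≤ m₂ ⊔ m₃) b hb
  have hc' := (le_sup_right : m₃ ≤ m₂ ⊔ m₃) c hc
  rw [Indep_iff] at h h'
  rw [Set.inter_assoc, h a (b ∩ c) ha (hb'.inter hc'), h' b c hb hc, h a b ha hb', mul_assoc]

end Independence

/-! ### Sampling probabilities -/

section SampleProb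

variable {P : SketchParams} {d : ℕ}

theorem sampleProb_mono (hC : 0 < P.C) (hε : 0 < P.ε) (hε1 : P.ε < 1) (hδ : 0 < P.δ)
    (hδ1 : P.δ < 1) : Monotone (sampleProb P d) := by
  intro x y hxy
  have hL : 0 ≤ d * Real.log (d / P.ε) + Real.log (1 / P.δ) := (logFactor_pos d hε hε1 hδ hδ1).le
  unfold sampleProb
  gcongr

theorem sampleProb_nonneg (hC : 0 < P.C) (hε : 0 < P.ε) (hε1 : P.ε < 1) (hδ : 0 < P.δ)
    (hδ1 : P.δ < 1) {x : ℝ} (hx : 0 ≤ x) : 0 ≤ sampleProb P d x := by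
  have := sampleProb_mono (d := d) hC hε hε1 hδ hδ1 hx
  simpa [sampleProb] using this

/-- The factor on the left is the `R` of the concentration bound; its condition `a ≤ R * r` thus
follows from `r` being at least the sampling probability of the sensitivity. -/
theorem mul_sampleProb (hC : 0 < P.C) (hε : 0 < P.ε) (hε1 : P.ε < 1) (hδ : 0 < P.δ)
    (hδ1 : P.δ < 1) (x : ℝ) :
    P.ε ^ 2 / (P.C * logFactor d P.ε P.δ) * sampleProb P d x = x := by
  have hL := logFactor_pos d hε hε1 hδ hδ1
  have : sampleProb P d x = P.C * x * logFactor d P.ε P.δ / P.ε ^ 2 := rfl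
  rw [this]
  field_simp

theorem measurable_sampleProb (P : SketchParams) (d : ℕ) : Measurable (sampleProb P d) := by
  unfold sampleProb
  fun_prop

end SampleProb

/-! ### The sampled matrix -/

section Deterministic

variable {T : Type*} {d s : ℕ} {P : SketchParams} {A : Fin s → Items T d}

/-- If the estimates of the inputs are at least the sensitivities up to the factor `(1 + ε) ^ t`,
then the sampling probabilities in the union are at least those for the sensitivities with respect
to the union. -/
theorem sampleProb_sensitivity_le_unionProb (hp : 0 < P.p) (hC : 0 < P.C) (hε : 0 < P.ε)
    (hε1 : P.ε < 1) (hδ : 0 < P.δ) (hδ1 : P.δ < 1) {m : ℕ} {t : Fin s → ℕ}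
    (hm : ∀ j, m + 1 ≤ t j) {τ : Fin s → T → ℝ}
    (hτ : ∀ j, ∀ a ∈ A j, (1 + P.ε) ^ t j * sensitivity P.p (vals (A j)) a.2 ≤ τ j a.1)
    {a : T × (Fin d → ℝ)} (ha : a ∈ unionItems A) :
    sampleProb P d ((1 + P.ε) ^ (m + 1) * sensitivity P.p (vals (unionItems A)) a.2) ≤
      unionProb P A τ a := by
  obtain ⟨j, hj⟩ := mem_unionItems.1 ha
  refine (sampleProb_mono hC hε hε1 hδ hδ1 ?_).trans (sampleProb_le_unionProb P τ hj)
  refine le_trans ?_ (hτ j a hj)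
  refine mul_le_mul (pow_le_pow_right₀ (by linarith) (hm j)) ?_ (sensitivity_nonneg _ _ _)
    (by positivity)
  exact sensitivity_vals_anti hp (fun b hb => mem_unionItems.2 ⟨j, hb⟩) hj

/-- The weighted sum of powers that the sampled rows yield for the vector `x`. -/
def weightedPow (p : ℝ) (B : Items T d) (r u : B → ℝ) (x : Fin d → ℝ) : ℝ :=
  ∑ a : B, sampleWeight (r a) (u a) * |a.1.2 ⬝ᵥ x| ^ p

/-- The sensitivity estimate from a weighted sample. -/
def sampleEstimate (P : SketchParams) (m : ℕ) (B : Items T d) (r u : B → ℝ) (v : Fin d → ℝ) : ℝ :=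
  (1 + P.ε) ^ m * (1 + P.ε / 4) * ⨆ x : Fin d → ℚ,
    |v ⬝ᵥ fun i => (x i : ℝ)| ^ P.p / weightedPow P.p B r u fun i => (x i : ℝ)

/-- The factor `1 + ε/4` turns the two-sided error of the sample into an overestimate by at most `1
+ ε`. `sampleEstimate` is visibly measurable in the probabilities and hash values; norm preservation
keeps the suprema finite, and then it agrees with the algorithm's estimate. -/
theorem sampleEstimate_spec (hp : 0 < P.p) (hε : 0 < P.ε) (hε1 : P.ε < 1) (m : ℕ)
    {h : T → ℝ} {τ : Fin s → T → ℝ} (hnn : ∀ a ∈ unionItems A, 0 ≤ unionProb P A τ a)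
    (hlow : ∀ x, (1 - P.ε / 4) * lpPow P.p ((vals (unionItems A)).mulVec x) ≤
      weightedPow P.p (unionItems A) (fun a => unionProb P A τ a.1) (fun a => h a.1.1) x)
    (hupp : ∀ x, weightedPow P.p (unionItems A) (fun a => unionProb P A τ a.1)
      (fun a => h a.1.1) x ≤ (1 + P.ε / 4) * lpPow P.p ((vals (unionItems A)).mulVec x))
    {a : T × (Fin d → ℝ)} (ha : a ∈ unionItems A) :
    sampleEstimate P m (unionItems A) (fun a => unionProb P A τ a.1) (fun a => h a.1.1) a.2 =
        (1 + P.ε) ^ m * (1 + P.ε / 4) *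
          sensitivity P.p (sampledMatrix P.p (unionSample P A h τ)) a.2 ∧
      (1 + P.ε) ^ m * sensitivity P.p (vals (unionItems A)) a.2 ≤
        sampleEstimate P m (unionItems A) (fun a => unionProb P A τ a.1) (fun a => h a.1.1) a.2 ∧
      sampleEstimate P m (unionItems A) (fun a => unionProb P A τ a.1) (fun a => h a.1.1) a.2 ≤
        (1 + P.ε) ^ (m + 1) * sensitivity P.p (vals (unionItems A)) a.2 := by
  have hM : ∀ x, lpPow P.p ((sampledMatrix P.p (unionSample P A h τ)).mulVec x) =
      weightedPow P.p (unionItems A) (fun a => unionProb P A τ a.1) (fun a => h a.1.1) x :=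
    lpPow_sampledMatrix_unionSample hp hnn
  obtain ⟨h1, h2, h3⟩ := sensitivity_bounds_of_lpPow_bounds
    (M := sampledMatrix P.p (unionSample P A h τ)) hp hε hε1
    (abs_dotProduct_le_lpPow_vals P.p ha) (fun x => (hM x).symm ▸ hlow x)
    (fun x => (hM x).symm ▸ hupp x)
  have hEq : sampleEstimate P m (unionItems A) (fun a => unionProb P A τ a.1)
      (fun a => h a.1.1) a.2 = (1 + P.ε) ^ m * (1 + P.ε / 4) *
        sensitivity P.p (sampledMatrix P.p (unionSample P A h τ)) a.2 := by
    rw [sampleEstimate, sensitivity_eq_iSup_rat hp h3]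
    simp only [hM]
  have hpow : 0 ≤ (1 + P.ε) ^ m := by positivity
  rw [hEq, mul_assoc, pow_succ, mul_assoc]
  exact ⟨rfl, mul_le_mul_of_nonneg_left h1 hpow, mul_le_mul_of_nonneg_left h2 hpow⟩

end Deterministic

/-! ### Measurability and the failure probability -/

section Measurability

variable {T Ω : Type*} {d s : ℕ}

theorem measurable_weightedPow [MeasurableSpace Ω] (p : ℝ) (B : Items T d) {r u : Ω → B → ℝ}
    (hr : ∀ a, Measurable fun ω => r ω a) (hu : ∀ a, Measurable fun ω => u ω a) (x : Fin d → ℝ) :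
    Measurable fun ω => weightedPow p B (r ω) (u ω) x :=
  Finset.measurable_fun_sum _ fun a _ =>
    (measurable_sampleWeight.comp ((hr a).prodMk (hu a))).mul_const _

/-- The supremum is over countably many rational vectors, hence measurable. -/
theorem measurable_sampleEstimate [MeasurableSpace Ω] (P : SketchParams) (m : ℕ) (B : Items T d)
    {r u : Ω → B → ℝ} (hr : ∀ a, Measurable fun ω => r ω a) (hu : ∀ a, Measurable fun ω => u ω a)
    (v : Fin d → ℝ) : Measurable fun ω => sampleEstimate P m B (r ω) (u ω) v :=
  (Measurable.iSup fun _ =>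
    measurable_const.div (measurable_weightedPow P.p B hr hu _)).const_mul _

theorem measurable_unionProb [MeasurableSpace Ω] (P : SketchParams) (A : Fin s → Items T d)
    {τ : Fin s → T → Ω → ℝ} (hτ : ∀ j k, Measurable (τ j k)) (a : T × (Fin d → ℝ)) :
    Measurable fun ω => unionProb P A (fun j k => τ j k ω) a :=
  Measurable.iSup fun _ => (measurable_sampleProb P d).comp (hτ _ _)

/-- If an event for two independent variables is unlikely for each fixed value of the first one,
then it is unlikely. -/
theorem measureReal_le_of_indepFun {α β : Type*} [MeasurableSpace Ω] [MeasurableSpace α]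
    [MeasurableSpace β] {μ : Measure Ω} [IsProbabilityMeasure μ] {X : Ω → α} {Y : Ω → β}
    (hX : Measurable X) (hY : Measurable Y) (hXY : IndepFun X Y μ) {B : Set (α × β)}
    (hB : MeasurableSet B) {δ : ℝ} (hδ : 0 ≤ δ) (h : ∀ x, μ.real {ω | (x, Y ω) ∈ B} ≤ δ) :
    μ.real {ω | (X ω, Y ω) ∈ B} ≤ δ := by
  have hmap := (indepFun_iff_map_prod_eq_prod_map_map hX.aemeasurable hY.aemeasurable).1 hXY
  have : IsProbabilityMeasure (μ.map X) := Measure.isProbabilityMeasure_map hX.aemeasurable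
  have : IsProbabilityMeasure (μ.map Y) := Measure.isProbabilityMeasure_map hY.aemeasurable
  refine ENNReal.toReal_le_of_le_ofReal hδ ?_
  calc μ {ω | (X ω, Y ω) ∈ B} = (μ.map fun ω => (X ω, Y ω)) B :=
        (Measure.map_apply (hX.prodMk hY) hB).symm
    _ = ∫⁻ x, μ.map Y (Prod.mk x ⁻¹' B) ∂(μ.map X) := by rw [hmap, Measure.prod_apply hB]
    _ ≤ ∫⁻ _, ENNReal.ofReal δ ∂(μ.map X) := by
        refine lintegral_mono fun x => ?_
        rw [Measure.map_apply hY (measurable_prodMk_left hB),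
          ENNReal.le_ofReal_iff_toReal_le (measure_ne_top _ _) hδ]
        exact h x
    _ = ENNReal.ofReal δ := by simp

end Measurability

/-! ### A finite test for norm preservation -/

/-- The image of the matrix of the values, as a subspace of `ℓ_p`. -/
def lpRange {T : Type*} {d : ℕ} (p : ℝ) (B : Items T d) :
    Submodule ℝ (PiLp (ENNReal.ofReal p) fun _ : B => ℝ) :=
  LinearMap.range
    ((WithLp.linearEquiv (ENNReal.ofReal p) ℝ (B → ℝ)).symm.toLinearMap ∘ₗ (vals B).mulVecLin)

theorem finrank_lpRange_le {T : Type*} {d : ℕ} (p : ℝ) (B : Items T d) :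
    Module.finrank ℝ (lpRange p B) ≤ d :=
  (LinearMap.finrank_range_le _).trans_eq (by simp)

/-- Finitely many conditions that are satisfied by independent samples with high probability, and
that ensure that the sampled matrix preserves all norms. -/
theorem exists_finite_test {T Ω : Type*} [MeasurableSpace Ω] {μ : Measure Ω}
    [IsProbabilityMeasure μ] {d : ℕ} {P : SketchParams} (hp : 1 ≤ P.p)
    (hC : minSampleConst P.p ≤ P.C) (hε : 0 < P.ε) (hε1 : P.ε < 1) (hδ : 0 < P.δ) (hδ1 : P.δ < 1)
    (h1 : d = 1 → P.ε * P.δ ≤ 1 / 2) (B : Items T d) {u : B → Ω → ℝ}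
    (hu : ∀ i, Measurable (u i))
    (hunif : ∀ i, μ.map (u i) = volume.restrict (Set.Icc (0 : ℝ) 1)) (hind : iIndepFun u μ) :
    ∃ N : Finset (Fin d → ℝ),
      (∀ r : B → ℝ, (∀ a, sampleProb P d (sensitivity P.p (vals B) a.1.2) ≤ r a) →
        μ.real {ω | ∃ x ∈ N, P.ε / (24 * P.p) <
          |weightedPow P.p B r (fun a => u a ω) x - 1|} ≤ P.δ) ∧
      ∀ r v : B → ℝ, (∀ a, 0 ≤ r a) →
        (∀ x ∈ N, |weightedPow P.p B r v x - 1| ≤ P.ε / (24 * P.p)) → ∀ x,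
          (1 - P.ε / 4) * lpPow P.p ((vals B).mulVec x) ≤ weightedPow P.p B r v x ∧
            weightedPow P.p B r v x ≤ (1 + P.ε / 4) * lpPow P.p ((vals B).mulVec x) := by
  classical
  have hp0 : 0 < P.p := by linarith
  have hC0 := (minSampleConst_pos hp).trans_le hC
  have : Fact (1 ≤ ENNReal.ofReal P.p) := ⟨ENNReal.one_le_ofReal.2 hp⟩
  have hη : 0 < P.ε / (24 * P.p) := by positivity
  have hη1 : P.ε / (24 * P.p) ≤ 1 := by rw [div_le_one (by positivity)]; linarith
  -- The net depends on `B` alone, so it is fixed before the random probabilities `r` are known.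
  obtain ⟨S, hS1, hScov, hScard⟩ := exists_sphere_net (lpRange P.p B) hη hη1
  have hpre : ∀ y : lpRange P.p B, ∃ x, (vals B).mulVec x = y.1.ofLp := by
    rintro ⟨_, x, rfl⟩
    exact ⟨x, rfl⟩
  choose g hg using hpre
  have hgw : ∀ (r v : B → ℝ) (y : lpRange P.p B), weightedPow P.p B r v (g y) =
      ∑ i, sampleWeight (r i) (v i) * |y.1 i| ^ P.p := by
    intro r v y
    refine Finset.sum_congr rfl fun i _ => ?_
    rw [← congrFun (hg y) i]
    rfl
  refine ⟨S.image g, fun r hr => ?_, fun r v hr hN x => ?_⟩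
  · simp only [Finset.exists_mem_image, hgw]
    refine measureReal_net_failure_le hu hunif hind hp hC hε hε1 hδ hδ1 h1 (lpRange P.p B)
      (finrank_lpRange_le _ _) S hS1 hScard fun y hy i => ?_
    rw [← hg ⟨y, hy⟩]
    refine (le_sensitivity_mul hp0 (abs_dotProduct_le_lpPow_vals P.p i.2) _).trans
      (mul_le_mul_of_nonneg_right ?_ (lpPow_nonneg _ _))
    have hL := logFactor_pos d hε hε1 hδ hδ1
    calc _ = _ := (mul_sampleProb (d := d) hC0 hε hε1 hδ hδ1 _).symm
      _ ≤ _ := mul_le_mul_of_nonneg_left (hr i) (by positivity)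
  · have hy : (WithLp.linearEquiv (ENNReal.ofReal P.p) ℝ (B → ℝ)).symm ((vals B).mulVec x) ∈
        lpRange P.p B := ⟨x, rfl⟩
    refine weighted_lpPow_bounds_of_net hp hε hε1 rfl (lpRange P.p B) (S : Set (lpRange P.p B))
      hScov (fun i => sampleWeight (r i) (v i)) (fun i => sampleWeight_nonneg (hr i) _)
      (fun y hy => ?_) ⟨_, hy⟩
    rw [← hgw]
    exact hN _ (Finset.mem_image_of_mem g hy)

/-! ### The theorem -/

theorem mergeOrFail_some {T : Type*} {d s m : ℕ} {t : Fin s → ℕ} (P : SketchParams)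
    (h : ℕ → T → ℝ) (hm : ∀ j, m + 1 ≤ t j) (S : ∀ j, Sketch T d (t j)) :
    mergeOrFail P h hm (fun j => some (S j)) = mergeSketches P h hm S := by
  simp [mergeOrFail]

theorem isSketch_mergeOrFail {T Ω : Type*} [mΩ : MeasurableSpace Ω] {μ : Measure Ω}
    [IsProbabilityMeasure μ] {h : ℕ → T → Ω → ℝ} (hh : IsRandomHash μ h) {d : ℕ} {P : SketchParams}
    (hp : 1 ≤ P.p) (hC : minSampleConst P.p ≤ P.C) (hε : 0 < P.ε) (hε1 : P.ε < 1) (hδ : 0 < P.δ)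
    (hδ1 : P.δ < 1) (h1 : d = 1 → P.ε * P.δ ≤ 1 / 2) {s : ℕ} {A : Fin s → Items T d}
    (hA : ∀ i j, Conforming (A i) (A j)) {t : Fin s → ℕ} {γ : Fin s → ℝ}
    {𝒢 : Fin s → MeasurableSpace Ω} {S : ∀ j, Ω → Option (Sketch T d (t j))}
    (hS : ∀ j, IsSketch μ h P (𝒢 j) (t j) (γ j) (A j) (S j)) {m : ℕ} (hm : ∀ j, m + 1 ≤ t j)
    (hind : Indep (⨆ j, 𝒢 j) (hashSigma h (Set.Iio (m + 1))) μ) :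
    IsSketch μ h P ((⨆ j, 𝒢 j) ⊔ hashSigma h {m}) m (P.δ + ∑ j, γ j) (unionItems A)
      (fun ω => mergeOrFail P (fun i k => h i k ω) hm (fun j => S j ω)) := by
  classical
  have hp0 : 0 < P.p := by linarith
  have hC0 := (minSampleConst_pos hp).trans_le hC
  have h𝒢 : (⨆ j, 𝒢 j) ≤ mΩ := iSup_le fun j => (hS j).le
  have hle : (⨆ j, 𝒢 j) ⊔ hashSigma h {m} ≤ mΩ := sup_le h𝒢 (hashSigma_le hh _)
  have hmem : ∀ I : Set ℕ, I ⊆ Set.Iio (m + 1) → hashSigma h I ≤ hashSigma h (Set.Iio (m + 1)) :=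
    fun I hI => biSup_mono fun i hi => hI hi
  have hm_sub : ({m} : Set ℕ) ⊆ Set.Iio (m + 1) := by simp
  have hlt_sub : Set.Iio m ⊆ Set.Iio (m + 1) := Set.Iio_subset_Iio (Nat.le_succ m)
  refine ⟨hle, ?_, ?_⟩
  · refine indep_sup_left_of_indep_sup_right h𝒢 (hashSigma_le hh _) (hashSigma_le hh _)
      (indep_of_indep_of_le_right hind (sup_le (hmem _ hm_sub) (hmem _ hlt_sub)))
      (indep_hashSigma hh ?_)
    simp
  choose τ hτ E hE hγ hgood using fun j => (hS j).exists_estimates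
  set B := unionItems A with hBdef
  have hB : IsDataset B := isDataset_unionItems hA
  let u : B → Ω → ℝ := fun a => h m a.1.1
  let r : Ω → B → ℝ := fun ω a => unionProb P A (fun j k => τ j k ω) a.1
  have hr𝒢 : Measurable[⨆ j, 𝒢 j] r :=
    @measurable_pi_lambda _ _ _ (⨆ j, 𝒢 j) _ _ fun a =>
      @measurable_unionProb T Ω d s (⨆ j, 𝒢 j) P A τ
        (fun j k => (hτ j k).mono (le_iSup 𝒢 j) le_rfl) a.1
  have hum : ∀ a, Measurable[hashSigma h {m}] (u a) := fun a =>
    measurable_hashSigma h (Set.mem_singleton m) _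
  -- Conformity gives distinct items of the union distinct keys, hence independent hash values.
  have hinj : Function.Injective fun a : B => (m, a.1.1) := fun a b hab =>
    Subtype.ext (Prod.ext (Prod.ext_iff.1 hab).2 (hB _ a.2 _ b.2 (Prod.ext_iff.1 hab).2))
  have hu : ∀ a, Measurable (u a) := fun a => hh.measurable m _
  obtain ⟨N, hN1, hN2⟩ := exists_finite_test hp hC hε hε1 hδ hδ1 h1 B (u := u) hu
    (fun a => hh.uniform m _) (hh.indep.precomp hinj)
  -- Admissibility of the probabilities is part of the event: for inadmissible ones the slice is
  -- empty, so every slice has probability at most `δ`.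
  let bad : Set ((B → ℝ) × (B → ℝ)) := {z |
    (∀ a, sampleProb P d (sensitivity P.p (vals B) a.1.2) ≤ z.1 a) ∧
      ∃ x ∈ N, P.ε / (24 * P.p) < |weightedPow P.p B z.1 z.2 x - 1|}
  have hbad : MeasurableSet bad := by
    have e : bad = (⋂ a, {z | sampleProb P d (sensitivity P.p (vals B) a.1.2) ≤ z.1 a}) ∩
        ⋃ x ∈ N, {z | P.ε / (24 * P.p) < |weightedPow P.p B z.1 z.2 x - 1|} := by
      ext z; simp [bad]
    rw [e]
    refine (MeasurableSet.iInter fun a => measurableSet_le measurable_const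
      (by fun_prop)).inter
      (N.measurableSet_biUnion fun x _ => measurableSet_lt measurable_const ?_)
    exact ((measurable_weightedPow P.p B (r := fun z : (B → ℝ) × (B → ℝ) => z.1)
      (u := fun z => z.2) (fun a => by fun_prop) (fun a => by fun_prop) x).sub_const 1).abs
  have hrm : Measurable r := hr𝒢.mono h𝒢 le_rfl
  have hindep : IndepFun r (fun ω a => u a ω) μ := by
    refine indep_of_indep_of_le_left (indep_of_indep_of_le_right hind ?_) hr𝒢.comap_le
    exact Measurable.comap_le (@measurable_pi_lambda _ _ _ (hashSigma h (Set.Iio (m + 1))) _ _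
      fun a => (hum a).mono (hmem _ hm_sub) le_rfl)
  have hbadprob : μ.real {ω | (r ω, fun a => u a ω) ∈ bad} ≤ P.δ := by
    refine measureReal_le_of_indepFun hrm (measurable_pi_lambda _ hu) hindep hbad hδ.le fun x => ?_
    by_cases hx : ∀ a, sampleProb P d (sensitivity P.p (vals B) a.1.2) ≤ x a
    · exact (measureReal_mono fun ω hω => hω.2).trans (hN1 x hx)
    · have : {ω | (x, fun a => u a ω) ∈ bad} = ∅ :=
        Set.eq_empty_of_forall_notMem fun ω hω => hx hω.1
      rw [this, measureReal_empty]
      exact hδ.le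
  have hrm' : ∀ a, Measurable[(⨆ j, 𝒢 j) ⊔ hashSigma h {m}] fun ω => r ω a := fun a =>
    ((measurable_pi_apply a).comp hr𝒢).mono le_sup_left le_rfl
  have hum' : ∀ a, Measurable[(⨆ j, 𝒢 j) ⊔ hashSigma h {m}] fun ω => u a ω := fun a =>
    (hum a).mono le_sup_right le_rfl
  -- Estimates are indexed by keys. For a key of `B` the sum has a single term; for other keys it is
  -- `0`.
  let τ' : T → Ω → ℝ := fun k ω => ∑ a ∈ B with a.1 = k,
    sampleEstimate P m B (r ω) (fun a => u a ω) a.2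
  have hτ'B : ∀ a ∈ B, ∀ ω, τ' a.1 ω = sampleEstimate P m B (r ω) (fun a => u a ω) a.2 := by
    intro a ha ω
    have : B.filter (fun b => b.1 = a.1) = {a} := by
      ext b
      simp only [Finset.mem_filter, Finset.mem_singleton]
      exact ⟨fun ⟨hb, hab⟩ => Prod.ext hab (hB b hb a ha hab), fun hba => by rw [hba]; exact ⟨ha, rfl⟩⟩
    simp only [τ', this, Finset.sum_singleton]
  refine ⟨τ', fun k => ?_, (⋂ j, E j) ∩ {ω | (r ω, fun a => u a ω) ∈ badᶜ}, ?_, ?_, ?_⟩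
  · exact @Finset.measurable_fun_sum _ _ _ _ _ _ ((⨆ j, 𝒢 j) ⊔ hashSigma h {m}) _ _ fun a _ =>
      @measurable_sampleEstimate T Ω d ((⨆ j, 𝒢 j) ⊔ hashSigma h {m}) P m B r (fun ω a => u a ω)
        hrm' hum' a.2
  · refine MeasurableSet.inter (MeasurableSet.iInter fun j =>
      ((le_iSup 𝒢 j).trans le_sup_left) _ (hE j)) ?_
    have hrp : Measurable[(⨆ j, 𝒢 j) ⊔ hashSigma h {m}] r :=
      @measurable_pi_lambda _ _ _ ((⨆ j, 𝒢 j) ⊔ hashSigma h {m}) _ _ hrm'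
    have hup : Measurable[(⨆ j, 𝒢 j) ⊔ hashSigma h {m}] fun ω (a : B) => u a ω :=
      @measurable_pi_lambda _ _ _ ((⨆ j, 𝒢 j) ⊔ hashSigma h {m}) _ _ hum'
    have hpair : Measurable[(⨆ j, 𝒢 j) ⊔ hashSigma h {m}] fun ω => (r ω, fun a => u a ω) :=
      hrp.prodMk hup
    exact hpair hbad.compl
  · have hEm : ∀ j, MeasurableSet (E j) := fun j => (hS j).le _ (hE j)
    have hbm : MeasurableSet {ω | (r ω, fun a => u a ω) ∈ bad} :=
      (hrm.prodMk (measurable_pi_lambda _ hu)) hbad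
    have hcompl : ((⋂ j, E j) ∩ {ω | (r ω, fun a => u a ω) ∈ badᶜ})ᶜ =
        (⋃ j, (E j)ᶜ) ∪ {ω | (r ω, fun a => u a ω) ∈ bad} := by
      ext ω
      simp [imp_iff_not_or]
    have hmeas : MeasurableSet ((⋂ j, E j) ∩ {ω | (r ω, fun a => u a ω) ∈ badᶜ}) :=
      (MeasurableSet.iInter hEm).inter hbm.compl
    have h2 := probReal_compl_eq_one_sub (μ := μ) hmeas
    have h3 : μ.real (⋃ j, (E j)ᶜ) ≤ ∑ j, γ j := by
      refine (measureReal_iUnion_fintype_le _).trans (Finset.sum_le_sum fun j _ => ?_)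
      rw [probReal_compl_eq_one_sub (hEm j)]
      linarith [hγ j]
    have h4 := measureReal_union_le (μ := μ) (⋃ j, (E j)ᶜ) {ω | (r ω, fun a => u a ω) ∈ bad}
    rw [hcompl] at h2
    linarith
  · rintro ω ⟨hωE, hωbad⟩
    have hω : ∀ j, ω ∈ E j := Set.mem_iInter.1 hωE
    have hprob : ∀ a ∈ B, sampleProb P d ((1 + P.ε) ^ (m + 1) * sensitivity P.p (vals B) a.2) ≤
        unionProb P A (fun j k => τ j k ω) a := fun a ha =>
      sampleProb_sensitivity_le_unionProb hp0 hC0 hε hε1 hδ hδ1 hm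
        (fun j a ha => ((hgood j ω (hω j)).1 a ha).1) ha
    have hmono := sampleProb_mono (d := d) hC0 hε hε1 hδ hδ1
    -- The embedding needs only the plain sensitivity; the factor `(1 + ε)^(m+1)` is the slack that
    -- keeps the new probabilities below the old ones.
    have hadm : ∀ a : B, sampleProb P d (sensitivity P.p (vals B) a.1.2) ≤ r ω a := fun a =>
      (hmono (le_mul_of_one_le_left (sensitivity_nonneg _ _ _)
        (one_le_pow₀ (by linarith)))).trans (hprob a.1 a.2)
    have hnn : ∀ a : B, 0 ≤ r ω a := fun a =>
      (sampleProb_nonneg hC0 hε hε1 hδ hδ1 (sensitivity_nonneg _ _ _)).trans (hadm a)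
    have hemb := hN2 (r ω) (fun a => u a ω) hnn fun x hx => by
      by_contra! hlt
      exact hωbad ⟨hadm, x, hx, hlt⟩
    have hspec := fun a (ha : a ∈ B) => sampleEstimate_spec hp0 hε hε1 m (h := fun k => h m k ω)
      (τ := fun j k => τ j k ω) (fun a ha => hnn ⟨a, ha⟩) (fun x => (hemb x).1)
      (fun x => (hemb x).2) ha
    refine ⟨fun a ha => ?_, ?_⟩
    · rw [hτ'B a ha]
      exact (hspec a ha).2
    · have hSω : (fun j => S j ω) = fun j => some fun i : Fin (t j) =>
          senSample P (A j) (fun k => h i k ω) (fun k => τ j k ω) :=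
        funext fun j => (hgood j ω (hω j)).2
      rw [hSω, mergeOrFail_some]
      refine mergeSketches_senSample hm (fun i k => h i k ω) (fun j k => τ j k ω)
        (fun k => τ' k ω) (fun a ha => ?_) fun a ha => ?_
      · rw [hτ'B a ha]
        exact (hspec a ha).1
      · rw [hτ'B a ha]
        exact (hmono (hspec a ha).2.2).trans (hprob a ha)

end

theorem mainTheorem9 (p : ℝ) (hp : 1 ≤ p) :
    ∃ C₀ : ℝ, 0 < C₀ ∧ ∀ C : ℝ, C₀ ≤ C →
      ∀ (d : ℕ) (ε δ : ℝ), 0 < ε → ε < 1 → 0 < δ → δ < 1 → (d = 1 → ε * δ ≤ 1 / 2) →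
      ∀ (T Ω : Type*) [MeasurableSpace Ω] (μ : Measure Ω) [IsProbabilityMeasure μ]
        (h : ℕ → T → Ω → ℝ), IsRandomHash μ h →
      ∀ (s : ℕ) (A : Fin s → Items T d),
        (∀ j, IsDataset (A j)) → (∀ i j, Conforming (A i) (A j)) →
      ∀ (t : Fin s → ℕ) (γ : Fin s → ℝ) (𝒢 : Fin s → MeasurableSpace Ω)
        (S : ∀ j, Ω → Option (Sketch T d (t j))),
        (∀ j, IsSketch μ h ⟨p, C, ε, δ⟩ (𝒢 j) (t j) (γ j) (A j) (S j)) →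
      ∀ (m : ℕ) (hm : IsLeast (Set.range t) (m + 1)),
        Indep (⨆ j, 𝒢 j) (hashSigma h (Set.Iio (m + 1))) μ →
        IsSketch μ h ⟨p, C, ε, δ⟩ ((⨆ j, 𝒢 j) ⊔ hashSigma h {m}) m (δ + ∑ j, γ j)
          (unionItems A)
          (fun ω => mergeOrFail ⟨p, C, ε, δ⟩ (fun i k => h i k ω)
            (fun j => hm.2 (Set.mem_range_self j)) (fun j => S j ω)) := by
  refine ⟨minSampleConst p, minSampleConst_pos hp, ?_⟩
  intro C hC d ε δ hε hε1 hδ hδ1 h1 T Ω _ μ _ h hh s A _ hA t γ 𝒢 S hS m hm hind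
  exact isSketch_mergeOrFail (P := ⟨p, C, ε, δ⟩) hh hp hC hε hε1 hδ hδ1 h1 hA hS
    (fun j => hm.2 (Set.mem_range_self j)) hind
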